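/- Let $n\ge 2$ and $\mathbf{k}=(k_1,\dots,k_n)\in\{2,3,\dots\}^n$, and put $[k]=\{1,\dots,k\}$ and $A=\prod_{i=1}^n[k_i]$. A game with player set $[n]$ and action sets $[k_i]$ consists of a total preorder $\succsim_i$ on $A$ for each player $i$; it is generic if, for every $i$, any two distinct profiles that differ only in the $i$-th coordinate are strictly ranked by $\succsim_i$. Let $\mathcal{G}(n,\mathbf{k})$ be the (finite) set of all such generic games. An action $a_i$ is a best-response to $a_{-i}$ if $(a_i,a_{-i})\succsim_i(x,a_{-i})$ for all $x\in[k_i]$, and $a\in A$ is a pure Nash equilibrium if every $a_i$ is a best-response to $a_{-i}$. A dynamic on $\mathcal{G}(n,\mathbf{k})$ specifies what each player $i$ observes at each time $t\ge 1$ and a strategy mapping observations to probability distributions on $[k_i]$; from an arbitrary initial profile $a^0$, at each time $t$ the players draw their actions $a^t_i$ independently according to their strategies. It is simple (uncoupled, 1-recall, stationary) if at each time $t$ player $i$ observes at most $\succsim_i$ and $a^{t-1}$, with no dependence on $t$. It converges almost surely to a pure Nash equilibrium of $g$ if, for every $a^0$, almost surely there are $T<\infty$ and a pure Nash equilibrium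 $a^*$ of $g$ with $a^t=a^*$ for all $t\ge T$. For $p=(p_1,\dots,p_n)\in(0,1)^n$, the best-response dynamic with inertia is the dynamic in which at each time $t$, independently, each player $i$ with probability $p_i$ plays the best-response to $a^{t-1}_{-i}$ and with probability $1-p_i$ repeats $a_i^{t-1}$. Theorem. There exist constants $c>0$ and $\delta>0$ such that for all $n\ge 2$ and all $\mathbf{k}\in\{2,3,\dots\}^n$ with $\max_i k_i\le\delta\sqrt{n/\log n}$, there is a simple dynamic on $\mathcal{G}(n,\mathbf{k})$ that converges almost surely to a pure Nash equilibrium in all but a fraction of at most $e^{-cn}$ of the games in $\mathcal{G}(n,\mathbf{k})$ that have a pure Nash equilibrium. In fact, for every choice of $p\in(0,1)^n$ the best-response dynamic with inertia with parameters $p$ is such a dynamic (with the same $c$ and $\delta$). -/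

import Mathlib

noncomputable section

namespace GameDynamics

/-- Action profiles of `n` players, where player `i` has the `k i` actions `Fin (k i)`. -/
abbrev Profile {n : ℕ} (k : Fin n → ℕ) : Type := (i : Fin n) → Fin (k i)

/-- A preference relation: a total preorder on the set of action profiles.
`P.rel a b` says that `a` is weakly preferred to `b`. -/
@[ext]
structure Preference {n : ℕ} (k : Fin n → ℕ) where
  rel : Profile k → Profile k → Prop
  total : ∀ a b, rel a b ∨ rel b a
  trans : ∀ a b c, rel a b → rel b c → rel a c

namespace Preference

variable {n : ℕ} {k : Fin n → ℕ}

/-- The asymmetric part of a preference relation. -/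
def Strict (P : Preference k) (a b : Profile k) : Prop := P.rel a b ∧ ¬ P.rel b a

/-- For player `i` with preference relation `P`, the action `x` is a best-response to `a_{-i}`.
(Only the coordinates of `a` other than `i` matter, as the `i`-th one is overwritten.) -/
def IsBestResponse (P : Preference k) (i : Fin n) (a : Profile k) (x : Fin (k i)) : Prop :=
  ∀ y : Fin (k i), P.rel (Function.update a i x) (Function.update a i y)

theorem exists_isBestResponse (P : Preference k) (i : Fin n) (a : Profile k) :
    ∃ x, P.IsBestResponse i a x := by
  have key : ∀ s : Finset (Fin (k i)), s.Nonempty →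
      ∃ x ∈ s, ∀ y ∈ s, P.rel (Function.update a i x) (Function.update a i y) := by
    intro s hs
    induction hs using Finset.Nonempty.cons_induction with
    | singleton b =>
      refine ⟨b, by simp, fun y hy => ?_⟩
      rw [Finset.mem_singleton.1 hy]
      exact (P.total _ _).elim id id
    | cons b s hb hs ih =>
      obtain ⟨x, hx, hmax⟩ := ih
      rcases P.total (Function.update a i x) (Function.update a i b) with h | h
      · refine ⟨x, Finset.mem_cons_of_mem hx, fun y hy => ?_⟩
        rcases Finset.mem_cons.1 hy with rfl | hy
        · exact h
        · exact hmax y hy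
      · refine ⟨b, Finset.mem_cons_self b s, fun y hy => ?_⟩
        rcases Finset.mem_cons.1 hy with rfl | hy
        · exact (P.total _ _).elim id id
        · exact P.trans _ _ _ h (hmax y hy)
  obtain ⟨x, -, hx⟩ := key Finset.univ ⟨a i, Finset.mem_univ _⟩
  exact ⟨x, fun y => hx y (Finset.mem_univ y)⟩

/-- A best-response of player `i` to `a_{-i}`. In a generic game it is the only one. -/
def bestResponse (P : Preference k) (i : Fin n) (a : Profile k) : Fin (k i) :=
  (P.exists_isBestResponse i a).choose

end Preference

/-- An (ordinal) game: a preference relation for each of the players. -/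
@[ext]
structure Game {n : ℕ} (k : Fin n → ℕ) where
  pref : Fin n → Preference k

namespace Game

variable {n : ℕ} {k : Fin n → ℕ}

/-- `a` is a pure Nash equilibrium of `g`. -/
def IsPureNash (g : Game k) (a : Profile k) : Prop :=
  ∀ i, (g.pref i).IsBestResponse i a (a i)

/-- `g` is generic: player `i` is never indifferent between distinct profiles that differ only in
the `i`-th coordinate. -/
def IsGeneric (g : Game k) : Prop :=
  ∀ (i : Fin n) (a b : Profile k), a ≠ b → (∀ j, j ≠ i → a j = b j) →
    (g.pref i).Strict a b ∨ (g.pref i).Strict b a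

end Game

/-- The set of generic games with `n` players in which player `i` has `k i` actions. -/
abbrev GenericGame {n : ℕ} (k : Fin n → ℕ) : Type := {g : Game k // g.IsGeneric}

/-- There are finitely many such games. -/
instance {n : ℕ} (k : Fin n → ℕ) : Finite (GenericGame k) := by
  have h1 : Finite (Preference k) :=
    Finite.of_injective (fun P : Preference k => P.rel) fun _ _ h => Preference.ext h
  have h2 : Finite (Game k) :=
    Finite.of_injective (fun g : Game k => g.pref) fun _ _ h => Game.ext h
  infer_instance

/-- Histories of play `(a^0, …, a^t)`. -/
abbrev History {n : ℕ} (k : Fin n → ℕ) (t : ℕ) : Type := Finset.Iic t → Profile k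

/-- The most recent action profile `a^t` of a history `(a^0, …, a^t)`. -/
def History.last {n : ℕ} {k : Fin n → ℕ} {t : ℕ} (h : History k t) : Profile k :=
  h ⟨t, Finset.mem_Iic.2 le_rfl⟩

/-- A dynamic on the set of generic games. `obs i t g h` is what player `i` observes at time `t + 1`
when the game `g` is played and the play so far is `h = (a^0, …, a^t)`; `strategy i` is the strategy
of player `i`, which turns an observation into a probability distribution over own actions. -/
structure Dynamic {n : ℕ} (k : Fin n → ℕ) where
  Obs : Fin n → Type
  obs : (i : Fin n) → (t : ℕ) → GenericGame k → History k t → Obs i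
  strategy : (i : Fin n) → Obs i → PMF (Fin (k i))

namespace Dynamic

variable {n : ℕ} {k : Fin n → ℕ}

/-- A dynamic is simple (uncoupled, 1-recall and stationary) if at each time what player `i`
observes is made from (at most) player `i`'s own preference relation and last period's action
profile, in the same way at all times. -/
def IsSimple (D : Dynamic k) : Prop :=
  ∀ i, ∃ φ : Preference k → Profile k → D.Obs i,
    ∀ (t : ℕ) (g : GenericGame k) (h : History k t), D.obs i t g h = φ (g.1.pref i) h.last

/-- The law of `a^{t+1}` given the history `(a^0, …, a^t)`: the players randomize independently of
each other, each according to their strategy. -/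
def step (D : Dynamic k) (g : GenericGame k) (t : ℕ) :
    ProbabilityTheory.Kernel (History k t) (Profile k) :=
  ProbabilityTheory.Kernel.ofFunOfCountable fun h =>
    MeasureTheory.Measure.pi fun i => (D.strategy i (D.obs i t g h)).toMeasure

instance (D : Dynamic k) (g : GenericGame k) (t : ℕ) :
    ProbabilityTheory.IsMarkovKernel (D.step g t) :=
  ⟨fun h => inferInstanceAs (MeasureTheory.IsProbabilityMeasure
    (MeasureTheory.Measure.pi fun i => (D.strategy i (D.obs i t g h)).toMeasure))⟩

/-- The law of the play `(a^0, a^1, a^2, …)` of the game `g` under the dynamic `D`, started at the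
action profile `a₀`. -/
def play (D : Dynamic k) (g : GenericGame k) (a₀ : Profile k) :
    MeasureTheory.Measure (ℕ → Profile k) :=
  ProbabilityTheory.Kernel.traj (X := fun _ => Profile k) (D.step g) 0 (fun _ => a₀)

/-- From any initial action profile, almost surely the play of `g` under `D` is eventually constant
and equal to some pure Nash equilibrium of `g`. -/
def ConvergesToPureNash (D : Dynamic k) (g : GenericGame k) : Prop :=
  ∀ a₀ : Profile k, ∀ᵐ a ∂(D.play g a₀),
    ∃ (T : ℕ) (e : Profile k), g.1.IsPureNash e ∧ ∀ t ≥ T, a t = e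

end Dynamic

/-- The distribution that puts mass `p` on `x` and mass `1 - p` on `y` (mass `1` if `x = y`). -/
def mix {α : Type} [Fintype α] [DecidableEq α] (p : Set.Ioo (0 : ℝ) 1) (x y : α) : PMF α :=
  PMF.ofFintype
    (fun z => (if z = x then ENNReal.ofReal p else 0) +
      (if z = y then ENNReal.ofReal (1 - p) else 0)) (by
    rw [Finset.sum_add_distrib, Finset.sum_ite_eq', Finset.sum_ite_eq',
      if_pos (Finset.mem_univ _), if_pos (Finset.mem_univ _),
      ← ENNReal.ofReal_add p.2.1.le (sub_nonneg.2 p.2.2.le), add_sub_cancel, ENNReal.ofReal_one])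

/-- The best-response dynamic with inertia: each player observes their own preference relation and
last period's action profile, and, independently of the others, player `i` plays the best-response
to the last actions of the others with probability `p i` and otherwise repeats their own action. -/
def bestResponseWithInertia {n : ℕ} (k : Fin n → ℕ) (p : Fin n → Set.Ioo (0 : ℝ) 1) :
    Dynamic k where
  Obs _ := Preference k × Profile k
  obs i _ g h := (g.1.pref i, h.last)
  strategy i o := mix (p i) (o.1.bestResponse i o.2) (o.2 i)

end GameDynamics

end

/-! Under inertia any set of players may jump to their best-responses simultaneously, with positive
probability. Equilibria are absorbing, so by a Markov chain argument the dynamic converges as soon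
as an equilibrium can be reached from every profile. It remains to bound the probability that a
random game has an equilibrium but lacks this reachability, and to divide by the probability of
having an equilibrium, which is at least 1/2 by a second moment argument. Since shifting actions
along lines permutes the generic games, best-responses on distinct lines are independent and uniform
(`pr_responses`).

Two estimates drive reachability. Forwards: whatever the distance between `s` and `t`, a path that
changes one action of `s` at a time to that of `t` exists with probability at least `exp (-K ^ 2)`
(`pathBound_le_pr`, `exp_le_pathBound`), and attempts that use disjoint lines are independent.
Backwards: around an equilibrium `e`, the profiles that reach `e` through moves of players in a set
`W` at least double from each level to the next, so that there are at least `2 ^ d` of them at level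
`d + 1`, with very high probability (`pr_isNash_and_card_level_lt_le`). The union bound over `e` is
free, because the expected number of equilibria is 1.

Split the players into halves `W` and `Wᶜ`. A profile with more than `2 * d` deviators has `d` of
them in one half, say off `W`. Letting subsets of these deviate opens a cube of `2 ^ d` points. From
the cube, paths in directions in `W` bring the members of `W` to any prescribed label `c`. From
there, paths in directions off `W` bring everyone else to the actions in `e`; distinct labels make
these attempts independent, and if `c` belongs to the backward level of `e`, play then continues to
`e`. With `2 ^ d` attempts in both phases, `d` of order `K ^ 2 + log n` beats the union bound over
all profiles, labels and sets (`pr_hasTrap_le`). A profile with few deviators that is not an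
equilibrium has a neighbour with many, unless two adjacent profiles are both quiet; this has
probability about `∏ i, 1 / k i`, up to a factor with logarithm of order `d * log n`
(`pr_hasQuietPair_le`). The latter is what requires `K ^ 2 * log n` to be small compared with `n`.
-/

noncomputable section
open Finset Function
open scoped BigOperators

namespace GameDynamics

/-! ### Uniform probability on finite types -/

section Probability

variable {Ω : Type*} [Fintype Ω]

/-- The probability of an event under the uniform distribution on a finite type. -/
def pr (E : Ω → Prop) : ℝ := 𝔼 ω, {ω | E ω}.indicator (fun _ => (1 : ℝ)) ω

theorem pr_nonneg (E : Ω → Prop) : 0 ≤ pr E :=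
  Finset.expect_nonneg fun _ _ => Set.indicator_nonneg (fun _ _ => zero_le_one) _

theorem pr_mono {E F : Ω → Prop} (h : ∀ ω, E ω → F ω) : pr E ≤ pr F :=
  Finset.expect_le_expect fun _ _ =>
    Set.indicator_le_indicator_of_subset (fun ω hω => h ω hω) (fun _ => zero_le_one) _

theorem pr_congr {E F : Ω → Prop} (h : ∀ ω, E ω ↔ F ω) : pr E = pr F := by
  have : E = F := funext fun ω => propext (h ω)
  rw [this]

theorem pr_or_le (E F : Ω → Prop) : pr (fun ω => E ω ∨ F ω) ≤ pr E + pr F := by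
  classical
  unfold pr
  rw [← Finset.expect_add_distrib]
  refine Finset.expect_le_expect fun ω _ => ?_
  by_cases h1 : E ω <;> by_cases h2 : F ω <;> simp [Set.indicator, h1, h2]

theorem pr_false : pr (fun _ : Ω => False) = 0 := by simp [pr]

theorem pr_true [Nonempty Ω] : pr (fun _ : Ω => True) = 1 := by
  simp [pr]

theorem pr_le_one [Nonempty Ω] (E : Ω → Prop) : pr E ≤ 1 :=
  (pr_mono fun _ _ => trivial).trans_eq pr_true

theorem pr_not [Nonempty Ω] (E : Ω → Prop) : pr (fun ω => ¬ E ω) = 1 - pr E := by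
  classical
  have : pr (fun ω => ¬ E ω) + pr E = 1 := by
    rw [← pr_true (Ω := Ω)]
    unfold pr
    rw [← Finset.expect_add_distrib]
    refine Finset.expect_congr rfl fun ω _ => ?_
    by_cases h1 : E ω <;> simp [Set.indicator, h1]
  linarith

theorem pr_exists_mem_le {ι : Type*} (s : Finset ι) (E : ι → Ω → Prop) :
    pr (fun ω => ∃ i ∈ s, E i ω) ≤ ∑ i ∈ s, pr (E i) := by
  classical
  induction s using Finset.induction_on with
  | empty => simp [pr_false]
  | insert a s ha ih =>
    rw [Finset.sum_insert ha]
    refine (pr_mono (F := fun ω => E a ω ∨ ∃ i ∈ s, E i ω) ?_).trans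
      ((pr_or_le _ _).trans (by gcongr))
    intro ω
    simp

theorem pr_exists_le {ι : Type*} [Fintype ι] (E : ι → Ω → Prop) :
    pr (fun ω => ∃ i, E i ω) ≤ ∑ i, pr (E i) := by
  simpa using pr_exists_mem_le Finset.univ E

theorem pr_exists_le_card_mul {ι : Type*} [Fintype ι] (E : ι → Ω → Prop) {r : ℝ}
    (h : ∀ i, pr (E i) ≤ r) : pr (fun ω => ∃ i, E i ω) ≤ Fintype.card ι * r := by
  refine (pr_exists_le E).trans ((Finset.sum_le_sum fun i _ => h i).trans_eq ?_)
  simp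

theorem pr_eq_ncard_div (E : Ω → Prop) :
    pr E = ({ω | E ω}.ncard : ℝ) / Nat.card Ω := by
  classical
  unfold pr
  rw [Fintype.expect_eq_sum_div_card, Nat.card_eq_fintype_card, Set.ncard_eq_toFinset_card']
  simp [Set.indicator, Finset.sum_boole]

/-- Markov's inequality. -/
theorem pr_le_expect {E : Ω → Prop} {f : Ω → ℝ} (h0 : ∀ ω, 0 ≤ f ω) (h1 : ∀ ω, E ω → 1 ≤ f ω) :
    pr E ≤ 𝔼 ω, f ω := by
  classical
  refine Finset.expect_le_expect fun ω _ => ?_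
  by_cases h : E ω <;> simp [Set.indicator, h, h0, h1]

end Probability

/-! ### Resampling and independence in product spaces -/

section Splice

variable {ι : Type*} {α : ι → Type*}

open Classical in
/-- The family that agrees with `ω'` on `S` and with `ω` off `S`. -/
def splice (S : Set ι) (ω' ω : ∀ i, α i) : ∀ i, α i := fun i => if i ∈ S then ω' i else ω i

theorem splice_of_mem {S : Set ι} {i : ι} (h : i ∈ S) (ω' ω : ∀ i, α i) :
    splice S ω' ω i = ω' i := by simp [splice, h]

theorem splice_of_notMem {S : Set ι} {i : ι} (h : i ∉ S) (ω' ω : ∀ i, α i) :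
    splice S ω' ω i = ω i := by simp [splice, h]

end Splice

section ProductSpace

variable {ι : Type*} [Fintype ι] [DecidableEq ι] {α : ι → Type*} [∀ i, Fintype (α i)]

theorem expect_prod (g : ∀ i, α i → ℝ) :
    𝔼 ω : ∀ i, α i, ∏ i, g i (ω i) = ∏ i, 𝔼 x, g i x := by
  simp only [Fintype.expect_eq_sum_div_card, Finset.prod_div_distrib]
  rw [Finset.prod_univ_sum, Fintype.piFinset_univ, Fintype.card_pi]
  push_cast
  rfl

variable [∀ i, Nonempty (α i)]

theorem expect_prod_finset (J : Finset ι) (g : ∀ i, α i → ℝ) :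
    𝔼 ω : ∀ i, α i, ∏ i ∈ J, g i (ω i) = ∏ i ∈ J, 𝔼 x, g i x := by
  have h := expect_prod (fun i x => if i ∈ J then g i x else 1)
  have h2 : ∀ i, (𝔼 x : α i, if i ∈ J then g i x else 1) = if i ∈ J then 𝔼 x, g i x else 1 := by
    intro i
    by_cases hi : i ∈ J <;> simp [hi]
  simpa only [h2, Finset.prod_ite_mem, Finset.univ_inter] using h

theorem pr_forall_mem_eq (J : Finset ι) (v : ∀ i, α i) :
    pr (fun ω : ∀ i, α i => ∀ i ∈ J, ω i = v i) = ∏ i ∈ J, (1 / Fintype.card (α i) : ℝ) := by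
  classical
  have h := expect_prod_finset J (fun i x => if x = v i then (1 : ℝ) else 0)
  have h2 : ∀ i, (𝔼 x : α i, if x = v i then (1 : ℝ) else 0) = 1 / Fintype.card (α i) := by
    intro i
    simp
  simp only [h2] at h
  rw [← h]
  refine Finset.expect_congr rfl fun ω _ => ?_
  rw [Finset.prod_ite_zero]
  simp [Set.indicator]

theorem pr_forall_mem_ne_eq (J : Finset ι) (v : ∀ i, α i) :
    pr (fun ω : ∀ i, α i => ∀ i ∈ J, ω i ≠ v i) =
      ∏ i ∈ J, (1 - 1 / Fintype.card (α i) : ℝ) := by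
  classical
  have h := expect_prod_finset J (fun i x => if x ≠ v i then (1 : ℝ) else 0)
  have h2 : ∀ i, (𝔼 x : α i, if x ≠ v i then (1 : ℝ) else 0) = 1 - 1 / Fintype.card (α i) := by
    intro i
    have h3 : ∀ x : α i, (if x ≠ v i then (1 : ℝ) else 0) = 1 - if x = v i then 1 else 0 := by
      intro x; by_cases hx : x = v i <;> simp [hx]
    simp only [h3, Finset.expect_sub_distrib]
    simp
  simp only [h2] at h
  rw [← h]
  refine Finset.expect_congr rfl fun ω _ => ?_
  rw [Finset.prod_ite_zero]
  simp [Set.indicator]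

/-- Resampling the coordinates off `S`. -/
theorem pr_eq_expect_splice (S : Set ι) (E : (∀ i, α i) → Prop) :
    pr E = 𝔼 ω', pr (fun ω => E (splice S ω' ω)) := by
  classical
  -- Swapping two independent samples off `S` is an involution of the set of pairs.
  let φ : ((∀ i, α i) × (∀ i, α i)) ≃ ((∀ i, α i) × (∀ i, α i)) :=
    { toFun := fun p => (splice S p.1 p.2, splice S p.2 p.1)
      invFun := fun p => (splice S p.1 p.2, splice S p.2 p.1)
      left_inv := fun p => by
        ext i <;> by_cases h : i ∈ S <;> simp [splice, h]
      right_inv := fun p => by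
        ext i <;> by_cases h : i ∈ S <;> simp [splice, h] }
  let f : (∀ i, α i) → ℝ := {ω | E ω}.indicator (fun _ => (1 : ℝ))
  have h1 : (𝔼 ω', pr (fun ω => E (splice S ω' ω))) = 𝔼 p : (∀ i, α i) × (∀ i, α i), f (φ p).1 := by
    rw [← Finset.univ_product_univ, Finset.expect_product]
    rfl
  rw [h1, Fintype.expect_equiv φ _ (fun p => f p.1) (fun _ => rfl), ← Finset.univ_product_univ,
    Finset.expect_product]
  simp only [Finset.expect_const Finset.univ_nonempty]
  rfl

/-- Conditioning on the coordinates in `S`: `F` is what `E` reveals about them, and `r` bounds the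
conditional probability of `E`. -/
theorem pr_le_mul_of_splice (S : Set ι) {E F : (∀ i, α i) → Prop} {r : ℝ}
    (h : ∀ ω', F ω' → pr (fun ω => E (splice S ω' ω)) ≤ r)
    (h' : ∀ ω' ω, E (splice S ω' ω) → F ω') : pr E ≤ r * pr F := by
  classical
  rw [pr_eq_expect_splice S, pr, Finset.mul_expect]
  refine Finset.expect_le_expect fun ω' _ => ?_
  by_cases hF : F ω'
  · simpa [Set.indicator, hF] using h ω' hF
  · have h0 : pr (fun ω => E (splice S ω' ω)) = 0 := by
      rw [← pr_false (Ω := ∀ i, α i)]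
      exact pr_congr fun ω => ⟨fun hE => hF (h' ω' ω hE), False.elim⟩
    simp [Set.indicator, hF, h0]

theorem mul_pr_le_of_splice (S : Set ι) {E F : (∀ i, α i) → Prop} {r : ℝ}
    (h : ∀ ω', F ω' → r ≤ pr (fun ω => E (splice S ω' ω))) : r * pr F ≤ pr E := by
  classical
  rw [pr_eq_expect_splice S E, pr, Finset.mul_expect]
  refine Finset.expect_le_expect fun ω' _ => ?_
  by_cases hF : F ω'
  · simpa [Set.indicator, hF] using h ω' hF
  · simpa [Set.indicator, hF] using pr_nonneg _

/-- Events that depend on disjoint sets of coordinates are independent; each induction step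
conditions on the coordinates of one event. -/
theorem pr_forall_mem_le_pow {κ : Type*} (C : Finset κ) (E : κ → (∀ i, α i) → Prop)
    (S : κ → Set ι) (hS : ∀ c ∈ C, ∀ c' ∈ C, c ≠ c' → Disjoint (S c) (S c'))
    (hE : ∀ c ∈ C, DependsOn (E c) (S c)) {r : ℝ} (hr : ∀ c ∈ C, pr (E c) ≤ r) :
    pr (fun ω => ∀ c ∈ C, E c ω) ≤ r ^ C.card := by
  classical
  induction C using Finset.induction_on with
  | empty => simp [pr_true]
  | insert c C hc ih =>
    have hr0 : 0 ≤ r := (pr_nonneg _).trans (hr c (by simp))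
    have ih := ih (fun a ha b hb => hS a (by simp [ha]) b (by simp [hb]))
      (fun a ha => hE a (by simp [ha])) (fun a ha => hr a (by simp [ha]))
    have key : pr (fun ω => ∀ a ∈ insert c C, E a ω) ≤ r ^ C.card * pr (E c) := by
      refine pr_le_mul_of_splice (S c) (fun ω' _ => ?_) (fun ω' ω h => ?_)
      · refine le_trans (pr_mono fun ω h a ha => ?_) ih
        have h1 := h a (by simp [ha])
        rwa [hE a (by simp [ha]) (y := ω)] at h1
        intro i hi
        refine splice_of_notMem (fun hi' => ?_) _ _
        exact Set.disjoint_left.1 (hS c (by simp) a (by simp [ha]) (by rintro rfl; exact hc ha))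
          hi' hi
      · have h1 := h c (by simp)
        rwa [hE c (by simp) (y := ω')] at h1
        exact fun i hi => splice_of_mem hi _ _
    rw [Finset.card_insert_of_notMem hc, pow_succ]
    exact key.trans (by gcongr; exact hr c (by simp))

end ProductSpace

theorem pr_comp_equiv {Ω Ω' : Type*} [Fintype Ω] [Fintype Ω'] (φ : Ω ≃ Ω') (E : Ω' → Prop) :
    pr (fun ω => E (φ ω)) = pr E :=
  Fintype.expect_equiv φ _ _ fun _ => rfl

/-! ### Independence of best-responses in a random generic game -/

section Shift

variable {n : ℕ} {k : Fin n → ℕ}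

/-- The best-responses in a game, as a function of the player and the profile. -/
def responses (g : Game k) (i : Fin n) (a : Profile k) : Fin (k i) := (g.pref i).bestResponse i a

theorem Preference.bestResponse_spec (P : Preference k) (i : Fin n) (a : Profile k) :
    P.IsBestResponse i a (P.bestResponse i a) := (P.exists_isBestResponse i a).choose_spec

theorem Game.IsGeneric.eq_responses {g : Game k} (hg : g.IsGeneric) {i : Fin n} {a : Profile k}
    {x : Fin (k i)} (hx : (g.pref i).IsBestResponse i a x) : x = responses g i a := by
  by_contra hne
  have h := (g.pref i).bestResponse_spec i a
  rcases hg i (update a i x) (update a i (responses g i a))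
    (fun he => hne (update_injective a i he))
    (fun j hj => by simp [hj]) with h1 | h1
  · exact h1.2 (h x)
  · exact h1.2 (hx _)

theorem responses_update {g : Game k} (hg : g.IsGeneric) (i : Fin n) (a : Profile k)
    (x : Fin (k i)) : responses g i (update a i x) = responses g i a := by
  refine hg.eq_responses fun y => ?_
  have h := (g.pref i).bestResponse_spec i (update a i x) y
  simpa [responses] using h

theorem Game.IsGeneric.isPureNash_iff {g : Game k} (hg : g.IsGeneric) (a : Profile k) :
    g.IsPureNash a ↔ ∀ i, responses g i a = a i := by
  refine forall_congr' fun i => ⟨fun h => (hg.eq_responses h).symm, fun h => ?_⟩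
  rw [← h]
  exact (g.pref i).bestResponse_spec i a

theorem exists_isGeneric (k : Fin n → ℕ) : ∃ g : Game k, g.IsGeneric := by
  classical
  let e := Fintype.equivFin (Profile k)
  refine ⟨⟨fun _ => ⟨fun a b => e a ≤ e b, fun a b => le_total _ _, fun a b c => le_trans⟩⟩, ?_⟩
  intro i a b hab _
  rcases lt_or_gt_of_ne (fun h => hab (e.injective h)) with h | h
  · exact Or.inl ⟨h.le, not_le.2 h⟩
  · exact Or.inr ⟨h.le, not_le.2 h⟩

instance : Nonempty (GenericGame k) := let ⟨g, hg⟩ := exists_isGeneric k; ⟨⟨g, hg⟩⟩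

variable [∀ i, NeZero (k i)]

/-- Best-response data: an action for each player `i` and each profile, of which only the profiles
in which player `i` plays `0` matter, as representatives of the lines in direction `i`. -/
abbrev Sample (k : Fin n → ℕ) : Type := (l : Fin n × Profile k) → Fin (k l.1)

/-- The best-response of player `i` to `a_{-i}` prescribed by `ω`. -/
def br (ω : Sample k) (i : Fin n) (a : Profile k) : Fin (k i) := ω (i, update a i 0)

theorem br_update (ω : Sample k) (i : Fin n) (a : Profile k) (x : Fin (k i)) :
    br ω i (update a i x) = br ω i a := by
  have h : update (update a i x) i 0 = update a i 0 := by simp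
  rw [br, h, br]

/-- Shift the action of player `i` by the amount that `ω` prescribes on its line. -/
def shiftProfile (ω : Sample k) (i : Fin n) (a : Profile k) : Profile k :=
  update a i (a i - br ω i a)

theorem shiftProfile_update (ω : Sample k) (i : Fin n) (a : Profile k) (x : Fin (k i)) :
    shiftProfile ω i (update a i x) = update a i (x - br ω i a) := by
  simp [shiftProfile, br_update]

theorem shiftProfile_neg (ω : Sample k) (i : Fin n) (a : Profile k) :
    shiftProfile ω i (shiftProfile (-ω) i a) = a := by
  rw [shiftProfile, shiftProfile, br_update]
  simp [br]

theorem shiftProfile_injective (ω : Sample k) (i : Fin n) : Injective (shiftProfile ω i) :=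
  HasLeftInverse.injective ⟨shiftProfile (-ω) i, fun a => by
    simpa using shiftProfile_neg (-ω) i a⟩

/-- The game in which every player `i` evaluates profiles after shifting their own action. -/
def shiftGame (ω : Sample k) (g : GenericGame k) : GenericGame k :=
  ⟨⟨fun i => ⟨fun a b => (g.1.pref i).rel (shiftProfile ω i a) (shiftProfile ω i b),
    fun _ _ => (g.1.pref i).total _ _, fun _ _ _ => (g.1.pref i).trans _ _ _⟩⟩,
    fun i a b hab h => g.2 i _ _ (fun he => hab (shiftProfile_injective ω i he))
      fun j hj => by simpa [shiftProfile, hj] using h j hj⟩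

theorem shiftGame_neg (ω : Sample k) (g : GenericGame k) :
    shiftGame (-ω) (shiftGame ω g) = g := by
  apply Subtype.ext
  apply Game.ext
  funext i
  apply Preference.ext
  funext a b
  change (g.1.pref i).rel (shiftProfile ω i (shiftProfile (-ω) i a))
    (shiftProfile ω i (shiftProfile (-ω) i b)) = _
  rw [shiftProfile_neg, shiftProfile_neg]

/-- Shifting by `ω` is a permutation of the set of generic games. -/
def shiftEquiv (ω : Sample k) : GenericGame k ≃ GenericGame k where
  toFun := shiftGame ω
  invFun := shiftGame (-ω)
  left_inv := shiftGame_neg ω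
  right_inv g := by simpa using shiftGame_neg (-ω) g

/-- Translating the action on a line translates the best-response there, so the shifts act on
best-response data by addition, which is transitive. -/
theorem responses_shiftGame (ω : Sample k) (g : GenericGame k) (i : Fin n) (a : Profile k) :
    responses (shiftGame ω g).1 i a = responses g.1 i a + br ω i a := by
  refine ((shiftGame ω g).2.eq_responses fun y => ?_).symm
  change (g.1.pref i).rel (shiftProfile ω i _) (shiftProfile ω i _)
  rw [shiftProfile_update, shiftProfile_update, add_sub_cancel_right]
  exact (g.1.pref i).bestResponse_spec i a _

/-- The best-responses in a uniformly random generic game are independent and uniform. -/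
theorem pr_responses [Fintype (GenericGame k)]
    (E : ((i : Fin n) → Profile k → Fin (k i)) → Prop) :
    pr (fun g : GenericGame k => E (responses g.1)) = pr (fun ω : Sample k => E (br ω)) := by
  -- Average over games and shifts together: for a fixed shift the game stays uniform, while for a
  -- fixed game the shifted responses are those of a uniform sample.
  have h1 : ∀ ω : Sample k, pr (fun g : GenericGame k => E (responses (shiftGame ω g).1)) =
      pr (fun g : GenericGame k => E (responses g.1)) := fun ω =>
    Fintype.expect_equiv (shiftEquiv ω) _ _ fun g => rfl
  have h2 : ∀ g : GenericGame k, pr (fun ω : Sample k => E (responses (shiftGame ω g).1)) =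
      pr (fun ω : Sample k => E (br ω)) := by
    intro g
    rw [← pr_comp_equiv (Equiv.addLeft (fun l => responses g.1 l.1 l.2 : Sample k))
      fun ω => E (br ω)]
    refine pr_congr fun ω => ?_
    have : responses (shiftGame ω g).1 = br ((fun l => responses g.1 l.1 l.2 : Sample k) + ω) := by
      funext i a
      simp [responses_shiftGame, br, responses_update g.2]
    rw [this]
    rfl
  have h3 : (𝔼 ω : Sample k, pr (fun g : GenericGame k => E (responses (shiftGame ω g).1))) =
      𝔼 g : GenericGame k, pr (fun ω : Sample k => E (responses (shiftGame ω g).1)) :=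
    Finset.expect_comm _ _ _
  simpa [h1, h2] using h3

end Shift

theorem one_div_natCast_le_one (K : ℕ) : 1 / (K : ℝ) ≤ 1 := by
  rw [one_div]
  exact Nat.cast_inv_le_one K

/-! ### Monotone paths between two profiles -/

section Paths

variable {n : ℕ} {k : Fin n → ℕ}

/-- Every player repeats their action or plays the best-response prescribed by `β`. -/
def Move (β : (i : Fin n) → Profile k → Fin (k i)) (a b : Profile k) : Prop :=
  ∀ i, b i = a i ∨ b i = β i a

/-- `b` can be reached from `a` by moves. -/
abbrev Reach (β : (i : Fin n) → Profile k → Fin (k i)) : Profile k → Profile k → Prop :=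
  Relation.ReflTransGen (Move β)

theorem move_update (β : (i : Fin n) → Profile k → Fin (k i)) (a : Profile k) (i : Fin n) :
    Move β a (update a i (β i a)) := by
  intro j
  by_cases h : j = i
  · subst h; simp
  · simp [h]

/-- The set of players whose actions in `s` and `t` differ. -/
def diff (s t : Profile k) : Finset (Fin n) := univ.filter fun i => s i ≠ t i

theorem mem_diff {s t : Profile k} {i : Fin n} : i ∈ diff s t ↔ s i ≠ t i := by simp [diff]

theorem diff_update {s t : Profile k} (i : Fin n) :
    diff (update s i (t i)) t = (diff s t).erase i := by
  ext j
  by_cases hj : j = i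
  · subst hj; simp [mem_diff]
  · simp [mem_diff, hj]

variable [∀ i, NeZero (k i)]

/-- There is a path from the given profile to `t` along which one player at a time moves to a
best-response that is their action in `t`. -/
inductive MonoReach (ω : Sample k) (t : Profile k) : Profile k → Prop
  | refl : MonoReach ω t t
  | step (s : Profile k) (i : Fin n) (hne : s i ≠ t i) (h : br ω i s = t i)
      (h' : MonoReach ω t (update s i (t i))) : MonoReach ω t s

theorem MonoReach.reach {ω : Sample k} {s t : Profile k} (h : MonoReach ω t s) :
    Reach (br ω) s t := by
  induction h with
  | refl => exact .refl
  | step s i hne h h' ih => exact .head (h ▸ move_update (br ω) s i) ih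

/-- The lines that monotone paths from `s` to `t` may use. -/
def pathLines (s t : Profile k) : Set (Fin n × Profile k) :=
  {l | ∃ i z, l = (i, update z i 0) ∧ z i ≠ t i ∧ ∀ j, z j = s j ∨ z j = t j}

theorem pathLines_update_subset (s t : Profile k) (i : Fin n) :
    pathLines (update s i (t i)) t ⊆ pathLines s t := by
  rintro l ⟨j, z, rfl, hne, hz⟩
  refine ⟨j, z, rfl, hne, fun m => ?_⟩
  by_cases hm : m = i
  · subst hm; simpa using Or.inr (hz m)
  · simpa [hm] using hz m

theorem MonoReach.congr {ω ω' : Sample k} {s t : Profile k} (h : MonoReach ω t s)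
    (hω : ∀ l ∈ pathLines s t, ω l = ω' l) : MonoReach ω' t s := by
  induction h with
  | refl => exact .refl
  | step s i hne h h' ih =>
    refine .step s i hne ?_ (ih fun l hl => hω l (pathLines_update_subset s t i hl))
    rw [← h]
    exact (hω _ ⟨i, s, rfl, hne, fun j => Or.inl rfl⟩).symm

theorem dependsOn_monoReach (s t : Profile k) :
    DependsOn (fun ω : Sample k => MonoReach ω t s) (pathLines s t) := fun _ _ h =>
  propext ⟨fun h' => h'.congr h, fun h' => h'.congr fun l hl => (h l hl).symm⟩

/-- Coordinate `j` is constant along all paths of either kind, with different values, so it tells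
their lines apart. -/
theorem disjoint_pathLines {s t s' t' : Profile k} {j : Fin n} (h : s j = t j) (h' : s' j = t' j)
    (hne : s j ≠ s' j) : Disjoint (pathLines s t) (pathLines s' t') := by
  refine Set.disjoint_left.2 ?_
  rintro l ⟨i, z, rfl, hi, hz⟩ ⟨i', z', he, hi', hz'⟩
  obtain ⟨rfl, he⟩ := Prod.mk.injEq .. ▸ he
  have hzj : z j = s j := (hz j).elim id fun hj => hj.trans h.symm
  have hzj' : z' j = s' j := (hz' j).elim id fun hj => hj.trans h'.symm
  have hji : j ≠ i := by
    rintro rfl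
    exact hi (hzj.trans h)
  have := congrFun he j
  simp only [update_of_ne hji] at this
  exact hne (by rw [← hzj, ← hzj', this])

/-- The line in direction `i` through `a`. -/
def line (a : Profile k) : Fin n ↪ Fin n × Profile k :=
  ⟨fun i => (i, update a i 0), fun _ _ h => (Prod.ext_iff.1 h).1⟩

theorem pr_forall_br_ne (s t : Profile k) (D : Finset (Fin n)) :
    pr (fun ω : Sample k => ∀ i ∈ D, br ω i s ≠ t i) = ∏ i ∈ D, (1 - 1 / (k i : ℝ)) := by
  have h := pr_forall_mem_ne_eq (α := fun l : Fin n × Profile k => Fin (k l.1)) (D.map (line s))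
    (fun l => t l.1)
  rw [Finset.prod_map] at h
  simp only [Fintype.card_fin] at h
  refine Eq.trans (pr_congr fun ω => ?_) h
  simp only [Finset.mem_map, forall_exists_index, and_imp]
  exact ⟨fun h l i hi hl => by subst hl; exact h i hi, fun h i hi => h _ i hi rfl⟩

/-- A lower bound for the probability that there is a monotone path between profiles that differ in
`m` coordinates. -/
def pathBound (K m : ℕ) : ℝ := ∏ j ∈ range m, (1 - (1 - 1 / (K : ℝ)) ^ (j + 1))

/-- At distance `m + 1`, some useful first move exists with probability at least `1 - (1 - 1 / K) ^
(m + 1)`, and the rest of the path only uses fresh lines. -/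
theorem pathBound_le_pr {K : ℕ} (hK : ∀ i, k i ≤ K) (t : Profile k) (m : ℕ) :
    ∀ s : Profile k, (diff s t).card = m →
      pathBound K m ≤ pr (fun ω : Sample k => MonoReach ω t s) := by
  induction m with
  | zero =>
    intro s hs
    have hst : s = t := by
      funext i
      by_contra h
      have := mem_diff.2 h
      rw [Finset.card_eq_zero.1 hs] at this
      simp at this
    subst hst
    rw [pathBound, Finset.prod_range_zero, ← pr_true (Ω := Sample k)]
    exact pr_mono fun ω _ => .refl
  | succ m ih =>
    intro s hs
    have hF : 1 - (1 - 1 / (K : ℝ)) ^ (m + 1) ≤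
        pr (fun ω : Sample k => ¬ ∀ i ∈ diff s t, br ω i s ≠ t i) := by
      rw [pr_not, pr_forall_br_ne, ← hs]
      have h1 : ∏ i ∈ diff s t, (1 - 1 / (k i : ℝ)) ≤ ∏ i ∈ diff s t, (1 - 1 / (K : ℝ)) := by
        refine Finset.prod_le_prod (fun i _ => ?_) fun i _ => ?_
        all_goals
          have h2 : (1 : ℝ) ≤ k i := by exact_mod_cast NeZero.one_le
          have h3 : (k i : ℝ) ≤ K := by exact_mod_cast hK i
        · rw [sub_nonneg, div_le_one (by linarith)]
          exact h2
        · gcongr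
      rw [Finset.prod_const] at h1
      linarith
    have h0 : 0 ≤ pathBound K m := by
      refine Finset.prod_nonneg fun j _ => sub_nonneg.2 (pow_le_one₀ ?_ ?_)
      · rw [sub_nonneg]
        exact one_div_natCast_le_one K
      · simp
    rw [pathBound, Finset.prod_range_succ]
    -- Condition on all lines through `s`. Once player `i` has moved, `i` plays `t i ≠ s i` forever
    -- and direction `i` is finished, so none of these lines is consulted again.
    refine (mul_le_mul_of_nonneg_left hF h0).trans
      (mul_pr_le_of_splice (Set.range (line s)) fun ω' hω' => ?_)
    push Not at hω'
    obtain ⟨i, hi, hbr⟩ := hω'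
    refine (ih (update s i (t i)) ?_).trans (pr_mono fun ω hω => ?_)
    · rw [diff_update, Finset.card_erase_of_mem hi, hs]; rfl
    · refine .step s i (mem_diff.1 hi) ?_ (hω.congr ?_)
      · rw [← hbr]
        exact splice_of_mem (S := Set.range (line s)) (i := line s i) ⟨i, rfl⟩ ω' ω
      · rintro l ⟨j, z, rfl, hj, hz⟩
        refine (splice_of_notMem ?_ _ _).symm
        rintro ⟨j', hj'⟩
        obtain ⟨rfl, he⟩ := Prod.mk.injEq .. ▸ hj'
        have hzi : z i = t i := by simpa using hz i
        have hij : i ≠ j' := by rintro rfl; exact hj hzi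
        have := congrFun he i
        simp only [update_of_ne hij] at this
        exact mem_diff.1 hi (this.trans hzi)

/-- If `1 - y ≥ 1 / K`, then `1 / (1 - y) = 1 + y / (1 - y) ≤ exp (K * y)`. With `y` running through
the powers of `ρ`, the exponents sum to at most `K * K`, whatever `m` is. -/
theorem exp_le_pathBound {K : ℕ} (hK : 1 ≤ K) (m : ℕ) :
    Real.exp (-(K : ℝ) ^ 2) ≤ pathBound K m := by
  have hK' : (1 : ℝ) ≤ K := by exact_mod_cast hK
  set ρ : ℝ := 1 - 1 / K with hρ
  have hρ0 : 0 ≤ ρ := sub_nonneg.2 (one_div_natCast_le_one K)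
  have hρ1 : ρ < 1 := by simp only [hρ]; linarith [show 0 < 1 / (K : ℝ) by positivity]
  have hterm : ∀ j, Real.exp (-(K * ρ ^ (j + 1))) ≤ 1 - ρ ^ (j + 1) := by
    intro j
    have hx : 1 / (K : ℝ) ≤ 1 - ρ ^ (j + 1) := by
      have : ρ ^ (j + 1) ≤ ρ := pow_le_of_le_one hρ0 hρ1.le (by omega)
      simp only [hρ] at this ⊢
      linarith
    have hpos : 0 < 1 - ρ ^ (j + 1) := lt_of_lt_of_le (by positivity) hx
    have h1 : (1 - ρ ^ (j + 1))⁻¹ ≤ Real.exp (K * ρ ^ (j + 1)) := by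
      refine le_trans ?_ (Real.add_one_le_exp _)
      have h2 : (1 - ρ ^ (j + 1))⁻¹ ≤ K := by
        rw [inv_le_comm₀ hpos (by linarith)]; simpa using hx
      have h3 : (1 - ρ ^ (j + 1))⁻¹ = (1 - ρ ^ (j + 1))⁻¹ * ρ ^ (j + 1) + 1 := by
        field_simp; ring
      rw [h3]
      gcongr
    rw [Real.exp_neg]
    exact inv_le_of_inv_le₀ hpos h1
  calc Real.exp (-(K : ℝ) ^ 2) ≤ Real.exp (∑ j ∈ range m, -(K * ρ ^ (j + 1))) := by
        refine Real.exp_le_exp.2 ?_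
        rw [Finset.sum_neg_distrib, neg_le_neg_iff, ← Finset.mul_sum, sq]
        gcongr
        calc ∑ j ∈ range m, ρ ^ (j + 1) ≤ ∑ j ∈ range m, ρ ^ j :=
              Finset.sum_le_sum fun j _ => pow_le_pow_of_le_one hρ0 hρ1.le (by omega)
          _ ≤ ∑' j, ρ ^ j := Summable.sum_le_tsum _ (fun _ _ => by positivity)
              (summable_geometric_of_lt_one hρ0 hρ1)
          _ = K := by
            rw [tsum_geometric_of_lt_one hρ0 hρ1, hρ, sub_sub_cancel, one_div, inv_inv]
    _ = ∏ j ∈ range m, Real.exp (-(K * ρ ^ (j + 1))) := Real.exp_sum _ _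
    _ ≤ pathBound K m := Finset.prod_le_prod (fun _ _ => (Real.exp_pos _).le) fun j _ => hterm j

/-- Attempts to find monotone paths that have distinct labels are independent. -/
theorem pr_forall_not_monoReach_le {K : ℕ} (hK1 : 1 ≤ K) (hK : ∀ i, k i ≤ K) {κ : Type*}
    (C : Finset κ) (s t : κ → Profile k)
    (hC : ∀ c ∈ C, ∀ c' ∈ C, c ≠ c' → ∃ j, s c j = t c j ∧ s c' j = t c' j ∧ s c j ≠ s c' j) :
    pr (fun ω : Sample k => ∀ c ∈ C, ¬ MonoReach ω (t c) (s c)) ≤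
      (1 - Real.exp (-(K : ℝ) ^ 2)) ^ C.card := by
  refine pr_forall_mem_le_pow C _ (fun c => pathLines (s c) (t c)) ?_ ?_ ?_
  · intro c hc c' hc' hne
    obtain ⟨j, h, h', hj⟩ := hC c hc c' hc' hne
    exact disjoint_pathLines h h' hj
  · intro c _ x y hxy
    exact congrArg Not (dependsOn_monoReach (s c) (t c) hxy)
  · intro c _
    rw [pr_not]
    have := (exp_le_pathBound hK1 _).trans (pathBound_le_pr hK (t c) _ (s c) rfl)
    linarith

end Paths

/-! ### Backward growth from an equilibrium -/

section Levels

variable {n : ℕ} {k : Fin n → ℕ}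

/-- The number of players other than `l.1` whose actions in `l.2` and `e` differ. -/
def lineLevel (e : Profile k) (l : Fin n × Profile k) : ℕ := ((diff l.2 e).erase l.1).card

variable [∀ i, NeZero (k i)]

theorem lineLevel_line (e b : Profile k) (j : Fin n) :
    lineLevel e (line b j) = (diff (update b j (e j)) e).card := by
  rw [diff_update]
  change ((diff (update b j 0) e).erase j).card = _
  congr 1
  ext i
  by_cases hi : i = j
  · simp [hi]
  · simp [mem_diff, hi]

/-- `a` is fixed by all best-responses prescribed by `ω`. -/
def IsNash (ω : Sample k) (a : Profile k) : Prop := ∀ i, br ω i a = a i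

theorem pr_isNash (e : Profile k) :
    pr (fun ω : Sample k => IsNash ω e) = ∏ i, (1 / (k i : ℝ)) := by
  have h := pr_forall_mem_eq (α := fun l : Fin n × Profile k => Fin (k l.1))
    (univ.map (line e)) (fun l => e l.1)
  rw [Finset.prod_map] at h
  simp only [Fintype.card_fin] at h
  refine Eq.trans (pr_congr fun ω => ?_) h
  simp only [Finset.mem_map, forall_exists_index, and_imp]
  exact ⟨fun h l i hi hl => by subst hl; exact h i, fun h i => h _ i (mem_univ i) rfl⟩

open Classical in
/-- The profiles from which a player in `W` moves to their action in `e` and thereby into `S`. -/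
def predecessors (ω : Sample k) (e : Profile k) (W : Finset (Fin n)) (S : Finset (Profile k)) :
    Finset (Profile k) :=
  univ.filter fun b => ∃ j ∈ W, b j ≠ e j ∧ update b j (e j) ∈ S ∧ br ω j b = e j

theorem mem_predecessors {ω : Sample k} {e : Profile k} {W : Finset (Fin n)}
    {S : Finset (Profile k)} {b : Profile k} : b ∈ predecessors ω e W S ↔
      ∃ j ∈ W, b j ≠ e j ∧ update b j (e j) ∈ S ∧ br ω j b = e j := by
  simp [predecessors]

/-- Profiles that differ from `e` in the actions of `l` members of `W` and reach `e` by `l` moves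
of single players. -/
def level (ω : Sample k) (e : Profile k) (W : Finset (Fin n)) : ℕ → Finset (Profile k)
  | 0 => {e}
  | l + 1 => predecessors ω e W (level ω e W l)

theorem diff_subset_of_mem_level {ω : Sample k} {e : Profile k} {W : Finset (Fin n)} {l : ℕ} :
    ∀ {b : Profile k}, b ∈ level ω e W l → diff b e ⊆ W ∧ (diff b e).card = l := by
  induction l with
  | zero =>
    intro b hb
    rw [level, mem_singleton] at hb
    subst hb
    simp [diff]
  | succ l ih =>
    intro b hb
    obtain ⟨j, hj, hne, hb', -⟩ := mem_predecessors.1 hb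
    obtain ⟨h1, h2⟩ := ih hb'
    rw [diff_update] at h1 h2
    have hjd := mem_diff.2 hne
    refine ⟨?_, ?_⟩
    · rw [← insert_erase hjd]
      exact insert_subset hj h1
    · rw [← insert_erase hjd, card_insert_of_notMem (by simp), h2]

theorem reach_of_mem_level {ω : Sample k} {e : Profile k} {W : Finset (Fin n)} {l : ℕ} :
    ∀ {b : Profile k}, b ∈ level ω e W l → Reach (br ω) b e := by
  induction l with
  | zero =>
    intro b hb
    rw [level, mem_singleton] at hb
    subst hb
    exact .refl
  | succ l ih =>
    intro b hb
    obtain ⟨j, hj, hne, hb', h⟩ := mem_predecessors.1 hb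
    exact .head (h ▸ move_update (br ω) b j) (ih hb')

/-- A move from level `l + 1` to level `l` uses a line of level `l`. So the levels are revealed by
successive disjoint sets of lines, and each stage has fresh randomness. -/
theorem predecessors_congr {ω ω' : Sample k} {e : Profile k} (W : Finset (Fin n))
    {S : Finset (Profile k)} {l : ℕ} (hS : ∀ u ∈ S, (diff u e).card = l)
    (h : ∀ m, lineLevel e m = l → ω m = ω' m) :
    predecessors ω e W S = predecessors ω' e W S := by
  ext b
  rw [mem_predecessors, mem_predecessors]
  refine exists_congr fun j => and_congr_right fun _ => and_congr_right fun _ =>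
    and_congr_right fun hu => ?_
  have : br ω j b = br ω' j b := h (line b j) (by rw [lineLevel_line, hS _ hu])
  rw [this]

theorem level_congr {ω ω' : Sample k} {e : Profile k} (W : Finset (Fin n)) {l : ℕ}
    (h : ∀ m, lineLevel e m < l → ω m = ω' m) : level ω e W l = level ω' e W l := by
  induction l with
  | zero => rfl
  | succ l ih =>
    rw [level, level, ← ih fun m hm => h m (by omega)]
    exact predecessors_congr W (fun u hu => (diff_subset_of_mem_level hu).2)
      fun m hm => h m (by omega)

theorem level_congr_of_dir {ω ω' : Sample k} {e : Profile k} {W : Finset (Fin n)} {l : ℕ}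
    (h : ∀ m : Fin n × Profile k, m.1 ∈ W → ω m = ω' m) : level ω e W l = level ω' e W l := by
  induction l with
  | zero => rfl
  | succ l ih =>
    rw [level, level, ih]
    ext b
    rw [mem_predecessors, mem_predecessors]
    refine exists_congr fun j => and_congr_right fun hj => ?_
    have : br ω j b = br ω' j b := h _ hj
    rw [this]

theorem isNash_congr {ω ω' : Sample k} {e : Profile k}
    (h : ∀ m, lineLevel e m = 0 → ω m = ω' m) (hω : IsNash ω e) : IsNash ω' e := fun i => by
  rw [← hω i]
  refine (h (line e i) ?_).symm
  rw [lineLevel_line, update_eq_self]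
  simp [diff]

/-- With `s = (m - 1) / K ≤ 1`, the inequality `exp (-s) ≤ 1 - s / 2` bounds the mean by `1 - s / (2
* m)`, and `(m - 1) / m ≥ 1 / 2`. The weight `1 / K` is what keeps `s` below 1. -/
theorem exp_neg_div_mix_le {K m : ℕ} (hm : 2 ≤ m) (hmK : m ≤ K) (y : Fin m) :
    (𝔼 x : Fin m, Real.exp (-((1 / K : ℝ) * if x = y then (m - 1 : ℝ) else 0))) ≤
      Real.exp (-(1 / (4 * K) : ℝ)) := by
  have hm' : (2 : ℝ) ≤ m := by exact_mod_cast hm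
  have hmK' : (m : ℝ) ≤ K := by exact_mod_cast hmK
  have hm0 : (0 : ℝ) < m := by linarith
  have hK0 : (0 : ℝ) < K := by linarith
  set s : ℝ := (1 / K : ℝ) * (m - 1) with hs
  have h1 : ∀ x : Fin m, Real.exp (-((1 / K : ℝ) * if x = y then (m - 1 : ℝ) else 0)) =
      1 - (if x = y then 1 - Real.exp (-s) else 0) := by
    intro x
    by_cases hx : x = y <;> simp [hx, hs]
  have hne : (univ : Finset (Fin m)).Nonempty := ⟨y, mem_univ y⟩
  simp only [h1, Finset.expect_sub_distrib]
  rw [Finset.expect_const hne, Fintype.expect_eq_sum_div_card, Finset.sum_ite_eq' univ y]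
  simp only [mem_univ, if_true, Fintype.card_fin]
  have hs0 : 0 ≤ s := mul_nonneg (by positivity) (by linarith)
  have hs1 : s ≤ 1 := by
    rw [hs, one_div, inv_mul_le_one₀ hK0]
    linarith
  have h2 : Real.exp (-s) ≤ 1 - s / 2 := by
    rw [Real.exp_neg]
    refine inv_le_of_inv_le₀ (by linarith) ?_
    refine le_trans ?_ (Real.add_one_le_exp s)
    rw [inv_le_iff_one_le_mul₀ (by linarith)]
    nlinarith
  have h3 : 1 / (4 * K : ℝ) ≤ (1 - Real.exp (-s)) / m := by
    have h4 : s / 2 / m ≤ (1 - Real.exp (-s)) / m := by gcongr; linarith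
    refine le_trans ?_ h4
    rw [hs, div_div, le_div_iff₀ (by positivity)]
    have : 1 / (4 * K : ℝ) * (2 * m) = 1 / K * (m / 2) := by field_simp; ring
    rw [this]
    gcongr
    linarith
  have := Real.add_one_le_exp (-(1 / (4 * K) : ℝ))
  linarith

/-- Double counting: if `j` answers `e j` on the line through `u`, all the other `k j - 1` profiles
on it are predecessors, and a predecessor arises at most once for each of the `l + 1` coordinates in
which it differs from `e`. -/
theorem card_predecessors_lower (ω : Sample k) (e : Profile k) (W : Finset (Fin n))
    {S : Finset (Profile k)} {l : ℕ} (hS : ∀ u ∈ S, (diff u e).card = l) :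
    (∑ p ∈ (S ×ˢ W).filter (fun p => p.1 p.2 = e p.2),
        if br ω p.2 p.1 = e p.2 then k p.2 - 1 else 0) ≤
      (predecessors ω e W S).card * (l + 1) := by
  classical
  let P := (S ×ˢ W).filter (fun p => p.1 p.2 = e p.2)
  let T : Finset (Profile k × Fin n) := univ.filter fun q =>
    q.2 ∈ W ∧ q.1 q.2 ≠ e q.2 ∧ update q.1 q.2 (e q.2) ∈ S ∧ br ω q.2 q.1 = e q.2
  have h1 : T.card ≤ (predecessors ω e W S).card * (l + 1) := by
    have hmaps : ∀ q ∈ T, q.1 ∈ predecessors ω e W S := by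
      intro q hq
      simp only [T, mem_filter, mem_univ, true_and] at hq
      exact mem_predecessors.2 ⟨q.2, hq⟩
    refine Finset.card_le_mul_card_image_of_maps_to hmaps (l + 1) (fun b hb => ?_) |>.trans_eq
      (mul_comm _ _)
    obtain ⟨j, hj, hne, hu, -⟩ := mem_predecessors.1 hb
    have hcard : (diff b e).card = l + 1 := by
      have := hS _ hu
      rw [diff_update] at this
      rw [← insert_erase (mem_diff.2 hne), card_insert_of_notMem (by simp), this]
    rw [← hcard]
    refine Finset.card_le_card_of_injOn (fun q => q.2) (fun q hq => ?_) ?_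
    · simp only [T, coe_filter, mem_filter, mem_univ, true_and, Set.mem_ofPred_eq] at hq
      rw [← hq.2]
      exact mem_diff.2 hq.1.2.1
    · intro q hq q' hq' h
      simp only [coe_filter, Set.mem_ofPred_eq] at hq hq'
      exact Prod.ext (hq.2.trans hq'.2.symm) h
  refine le_trans ?_ h1
  have hmaps : ∀ q ∈ T, (update q.1 q.2 (e q.2), q.2) ∈ P := by
    intro q hq
    simp only [T, mem_filter, mem_univ, true_and] at hq
    simp [P, hq.1, hq.2.2.1]
  rw [Finset.card_eq_sum_card_fiberwise hmaps]
  refine Finset.sum_le_sum fun p hp => ?_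
  obtain ⟨u, j⟩ := p
  simp only [mem_filter, mem_product] at hp
  obtain ⟨⟨huS, hjW⟩, huj⟩ := hp
  simp only at huS hjW huj ⊢
  split_ifs with hbr
  · have : k j - 1 = ((univ : Finset (Fin (k j))).erase (e j)).card := by
      rw [card_erase_of_mem (mem_univ _), card_univ, Fintype.card_fin]
    rw [this]
    have hu : update u j (e j) = u := by rw [← huj, update_eq_self]
    refine Finset.card_le_card_of_injOn (fun x => (update u j x, j)) (fun x hx => ?_) ?_
    · have hx : x ≠ e j := by simpa using hx
      simp [T, hjW, hx, hu, huS, br_update, hbr]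
    · intro x _ y _ hxy
      exact update_injective u j (Prod.ext_iff.1 hxy).1
  · exact Nat.zero_le _

/-- A Chernoff bound for the count in `card_predecessors_lower`: the pairs `(u, j)` with `u j = e j`
lie on distinct lines, and each contributes `(k j - 1) / k j ≥ 1 / 2` on average. There are at least
`S.card * (W.card - l)` pairs, so the constant 20 puts the mean well above `2 * S.card * (l + 1)`.
-/
theorem pr_card_predecessors_lt_le {K : ℕ} (hk : ∀ i, 2 ≤ k i) (hK : ∀ i, k i ≤ K)
    (e : Profile k) (W : Finset (Fin n)) {S : Finset (Profile k)} {l : ℕ}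
    (hS : ∀ u ∈ S, (diff u e).card = l) (hl : 20 * (l + 1) ≤ W.card) :
    pr (fun ω : Sample k => (predecessors ω e W S).card < 2 * S.card) ≤
      Real.exp (-(S.card * W.card / (10 * K) : ℝ)) := by
  classical
  rcases S.eq_empty_or_nonempty with rfl | hSne
  · simp [pr_false]
  have hK0 : (0 : ℝ) < K := by
    have hW : 0 < W.card := by omega
    obtain ⟨i, -⟩ := card_pos.1 hW
    have := (hk i).trans (hK i)
    exact_mod_cast (by omega : 0 < K)
  set P := (S ×ˢ W).filter (fun p => p.1 p.2 = e p.2) with hP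
  let f : Profile k × Fin n → Fin n × Profile k := fun p => line p.1 p.2
  have hf : Set.InjOn f P := by
    rintro ⟨u, j⟩ hp ⟨u', j'⟩ hp' h
    obtain ⟨hj, h⟩ := Prod.ext_iff.1 h
    change j = j' at hj
    subst hj
    change update u j 0 = update u' j 0 at h
    simp only [hP, coe_filter, Set.mem_ofPred_eq] at hp hp'
    have : u = u' := by
      have h1 : update (update u j 0) j (e j) = u := by rw [update_idem, ← hp.2, update_eq_self]
      have h2 : update (update u' j 0) j (e j) = u' := by
        rw [update_idem, ← hp'.2, update_eq_self]
      rw [← h1, h, h2]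
    rw [this]
  let g : (m : Fin n × Profile k) → Fin (k m.1) → ℝ := fun m x =>
    Real.exp (-((1 / K : ℝ) * if x = e m.1 then (k m.1 - 1 : ℝ) else 0))
  have hcardP : S.card * (W.card - l) ≤ P.card := by
    have : P.card = ∑ u ∈ S, (W.filter fun j => u j = e j).card := by
      rw [hP, Finset.card_filter, Finset.sum_product]
      simp only [Finset.card_filter]
    rw [this, ← smul_eq_mul]
    refine Finset.card_nsmul_le_sum _ _ _ fun u hu => ?_
    have h1 : (W.filter fun j => u j = e j) = W \ diff u e := by
      ext j; simp [mem_diff]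
    rw [h1, ← hS u hu]
    exact Finset.le_card_sdiff _ _
  have hmgf : (𝔼 ω : Sample k, ∏ p ∈ P, g (f p) (ω (f p))) ≤
      Real.exp (-(1 / (4 * K) : ℝ)) ^ P.card := by
    have h1 := expect_prod_finset (α := fun l : Fin n × Profile k => Fin (k l.1)) (P.image f) g
    have h2 : ∀ ω : Sample k, ∏ m ∈ P.image f, g m (ω m) = ∏ p ∈ P, g (f p) (ω (f p)) :=
      fun ω => Finset.prod_image hf
    rw [Finset.prod_image hf] at h1
    simp only [h2] at h1
    rw [h1]
    rw [← Finset.prod_const]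
    exact Finset.prod_le_prod (fun p _ => Finset.expect_nonneg fun _ _ => (Real.exp_pos _).le)
      fun p _ => exp_neg_div_mix_le (hk p.2) (hK p.2) (e p.2)
  have hmarkov := pr_le_expect
    (E := fun ω : Sample k => (predecessors ω e W S).card < 2 * S.card)
    (f := fun ω => Real.exp (1 / K * (2 * S.card * (l + 1))) * ∏ p ∈ P, g (f p) (ω (f p)))
    (fun ω => mul_nonneg (Real.exp_pos _).le (Finset.prod_nonneg fun _ _ => (Real.exp_pos _).le))
    (fun ω hω => by
      have h1 := card_predecessors_lower ω e W hS
      have h2 : ∏ p ∈ P, g (f p) (ω (f p)) = Real.exp (-(1 / K *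
          ((∑ p ∈ P, if br ω p.2 p.1 = e p.2 then k p.2 - 1 else 0 : ℕ) : ℝ))) := by
        rw [Nat.cast_sum, Finset.mul_sum, ← Finset.sum_neg_distrib, Real.exp_sum]
        refine Finset.prod_congr rfl fun p _ => ?_
        have h3 : (1 : ℕ) ≤ k p.2 := NeZero.one_le
        change Real.exp (-((1 / K : ℝ) *
          if br ω p.2 p.1 = e p.2 then (k p.2 - 1 : ℝ) else 0)) = _
        congr 3
        split_ifs
        · push_cast [h3]; rfl
        · simp
      rw [h2, ← Real.exp_add]
      refine Real.one_le_exp ?_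
      have h4 : ((∑ p ∈ P, if br ω p.2 p.1 = e p.2 then k p.2 - 1 else 0 : ℕ) : ℝ) ≤
          2 * S.card * (l + 1) := by
        have : (∑ p ∈ P, if br ω p.2 p.1 = e p.2 then k p.2 - 1 else 0) ≤
            2 * S.card * (l + 1) := h1.trans (by gcongr)
        exact_mod_cast this
      have := mul_le_mul_of_nonneg_left h4 (show (0 : ℝ) ≤ 1 / K by positivity)
      linarith)
  refine hmarkov.trans ?_
  rw [← Finset.mul_expect]
  refine (mul_le_mul_of_nonneg_left hmgf (Real.exp_pos _).le).trans ?_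
  rw [← Real.exp_nat_mul, ← Real.exp_add]
  refine Real.exp_le_exp.2 ?_
  have hlW : l ≤ W.card := by omega
  have h5 : (S.card : ℝ) * (W.card - l) ≤ P.card := by
    rw [← Nat.cast_sub hlW]
    exact_mod_cast hcardP
  have h6 : (20 : ℝ) * (l + 1) ≤ W.card := by exact_mod_cast hl
  have h7 : (0 : ℝ) ≤ S.card := by positivity
  have h8 : 1 / (K : ℝ) * (2 * S.card * (l + 1)) + P.card * -(1 / (4 * K)) =
      (2 * S.card * (l + 1) - P.card / 4) / K := by field_simp; ring
  have h9 : -(S.card * W.card / (10 * K) : ℝ) = (-(S.card * W.card / 10)) / K := by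
    field_simp
  rw [h8, h9]
  gcongr
  nlinarith

/-- At an equilibrium every line through `e` already points to `e`, so the first level needs no
randomness. -/
theorem card_le_card_level_one {ω : Sample k} (hk : ∀ i, 2 ≤ k i) {e : Profile k}
    (he : IsNash ω e) (W : Finset (Fin n)) : W.card ≤ (level ω e W 1).card := by
  have hx : ∀ j, ∃ x : Fin (k j), x ≠ e j := fun j => by
    have : Nontrivial (Fin (k j)) := Fin.nontrivial_iff_two_le.2 (hk j)
    exact exists_ne _
  choose x hx using hx
  refine Finset.card_le_card_of_injOn (fun j => update e j (x j)) (fun j hj => ?_) ?_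
  · refine mem_predecessors.2 ⟨j, hj, ?_, ?_, ?_⟩
    · simpa using hx j
    · simp [level]
    · rw [br_update, he j]
  · intro i _ j _ hij
    by_contra hne
    have := congrFun hij i
    simp only [update_self, update_of_ne hne] at this
    exact hx i this

theorem pr_isNash_and_card_level_lt_le {K : ℕ} (hk : ∀ i, 2 ≤ k i) (hK : ∀ i, k i ≤ K)
    (e : Profile k) (W : Finset (Fin n)) {d : ℕ} (hd : 20 * (d + 1) ≤ W.card) :
    pr (fun ω : Sample k => IsNash ω e ∧ (level ω e W (d + 1)).card < 2 ^ d) ≤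
      d * (Real.exp (-((W.card : ℝ) ^ 2 / (10 * K))) * ∏ i, (1 / (k i : ℝ))) := by
  have hstep : ∀ l ∈ Finset.Icc 1 d, pr (fun ω : Sample k => IsNash ω e ∧
      W.card ≤ (level ω e W l).card ∧ (level ω e W (l + 1)).card < 2 * (level ω e W l).card) ≤
      Real.exp (-((W.card : ℝ) ^ 2 / (10 * K))) * ∏ i, (1 / (k i : ℝ)) := by
    intro l hl
    rw [mem_Icc] at hl
    rw [← pr_isNash e]
    -- As `l ≥ 1`, the lines of level below `l` determine both level `l` and whether `e` is an
    -- equilibrium; the growth to level `l + 1` is decided by the lines of level `l`.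
    refine pr_le_mul_of_splice {m | lineLevel e m < l} (fun ω' _ => ?_) fun ω' ω h => ?_
    · have hlev : ∀ ω, level (splice {m | lineLevel e m < l} ω' ω) e W l = level ω' e W l :=
        fun ω => level_congr W fun m hm =>
          splice_of_mem (S := {m | lineLevel e m < l}) hm _ _
      have hS : ∀ u ∈ level ω' e W l, (diff u e).card = l :=
        fun u hu => (diff_subset_of_mem_level hu).2
      by_cases hw : W.card ≤ (level ω' e W l).card
      · refine (pr_mono fun ω h => ?_).trans ((pr_card_predecessors_lt_le hk hK e W hS
          (by omega)).trans ?_)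
        · have h2 := h.2.2
          rw [level, hlev, predecessors_congr (ω' := ω) W hS] at h2
          · exact h2
          · intro m hm
            exact splice_of_notMem (by simp [hm]) _ _
        · rw [Real.exp_le_exp, neg_le_neg_iff, sq]
          gcongr
      · refine (pr_mono (F := fun _ => False) fun ω h => hw ?_).trans
          (pr_false.trans_le (Real.exp_pos _).le)
        rw [← hlev ω]
        exact h.2.1
    · exact isNash_congr (fun m hm => splice_of_mem (S := {m | lineLevel e m < l})
        (show lineLevel e m < l by omega) _ _) h.1
  refine (pr_mono (F := fun ω => ∃ l ∈ Finset.Icc 1 d, IsNash ω e ∧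
    W.card ≤ (level ω e W l).card ∧ (level ω e W (l + 1)).card < 2 * (level ω e W l).card)
    fun ω h => ?_).trans ((pr_exists_mem_le _ _).trans ((Finset.sum_le_sum hstep).trans_eq ?_))
  · by_contra! hcon
    -- Level 1 has at least `W.card` members, and without a failure each later level doubles.
    have key : ∀ l ≤ d, 2 ^ l * W.card ≤ (level ω e W (l + 1)).card := by
      intro l
      induction l with
      | zero => intro _; simpa using card_le_card_level_one hk h.1 W
      | succ l ih =>
        intro hl
        have h1 := ih (by omega)
        have h2 := hcon (l + 1) (by simp; omega) h.1
          (le_trans (Nat.le_mul_of_pos_left _ (by positivity)) h1)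
        rw [pow_succ]
        linarith
    have h1 := key d le_rfl
    have h2 : 2 ^ d * 1 ≤ 2 ^ d * W.card := Nat.mul_le_mul_left _ (by omega)
    have h3 := h.2
    omega
  · simp

end Levels

/-! ### Reaching an equilibrium: traps and quiet pairs -/

section Connectivity

variable {n : ℕ} {k : Fin n → ℕ} [∀ i, NeZero (k i)]

theorem MonoReach.congr_of_diff_subset {ω ω' : Sample k} {s t : Profile k} (h : MonoReach ω t s)
    (hω : ∀ m : Fin n × Profile k, s m.1 ≠ t m.1 → ω m = ω' m) : MonoReach ω' t s := by
  refine h.congr ?_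
  rintro l ⟨i, z, rfl, hne, hz⟩
  refine hω _ fun h => hne ?_
  exact (hz i).elim (fun h' => h'.trans h) id

/-- From some profile in the cube spanned by `x` and `y` in the directions in `T` there is a monotone
path to a profile in which the members of `W` play as in `c`. -/
def CubeReaches (ω : Sample k) (W T : Finset (Fin n)) (x y c : Profile k) : Prop :=
  ∃ T' ⊆ T, MonoReach ω (W.piecewise c (T'.piecewise y x)) (T'.piecewise y x)

/-- The paths move only members of `W`, so the actions on `T` stay fixed and distinguish the `2 ^
T.card` starting points: the attempts are independent. -/
theorem pr_not_cubeReaches_le {K : ℕ} (hK1 : 1 ≤ K) (hK : ∀ i, k i ≤ K) {W T : Finset (Fin n)}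
    (hWT : Disjoint W T) {x y : Profile k} (hxy : ∀ i ∈ T, y i ≠ x i) (c : Profile k) :
    pr (fun ω : Sample k => ¬ CubeReaches ω W T x y c) ≤
      (1 - Real.exp (-(K : ℝ) ^ 2)) ^ 2 ^ T.card := by
  classical
  rw [← card_powerset]
  refine (pr_mono fun ω h T' hT' => ?_).trans (pr_forall_not_monoReach_le hK1 hK T.powerset
    (fun T' => T'.piecewise y x) (fun T' => W.piecewise c (T'.piecewise y x)) ?_)
  · exact fun hm => h ⟨T', mem_powerset.1 hT', hm⟩
  · intro A hA B hB hAB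
    rw [mem_powerset] at hA hB
    obtain ⟨j, hj⟩ : ∃ j, ¬ (j ∈ A ↔ j ∈ B) := by
      by_contra! h
      exact hAB (Finset.ext h)
    have hjT : j ∈ T := by
      by_contra h
      exact hj ⟨fun h' => absurd (hA h') h, fun h' => absurd (hB h') h⟩
    have hjW : j ∉ W := fun h => disjoint_left.1 hWT h hjT
    refine ⟨j, by simp [hjW], by simp [hjW], ?_⟩
    by_cases h1 : j ∈ A <;> by_cases h2 : j ∈ B
    · exact absurd (by simp [h1, h2]) hj
    · simpa [h1, h2] using hxy j hjT
    · simpa [h1, h2] using (hxy j hjT).symm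
    · exact absurd (by simp [h1, h2]) hj

/-- Given that many labels on `W` lead to `e`, some profile in the cube reaches `e`. -/
theorem pr_not_reach_le {K : ℕ} (hK1 : 1 ≤ K) (hK : ∀ i, k i ≤ K) (W T : Finset (Fin n))
    (x y e : Profile k) (L M : ℕ) :
    pr (fun ω : Sample k => M ≤ (level ω e W L).card ∧ (∀ c, CubeReaches ω W T x y c) ∧
      ∀ T' ⊆ T, ¬ Reach (br ω) (T'.piecewise y x) e) ≤ (1 - Real.exp (-(K : ℝ) ^ 2)) ^ M := by
  classical
  have hq0 : 0 ≤ 1 - Real.exp (-(K : ℝ) ^ 2) := by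
    rw [sub_nonneg, Real.exp_le_one_iff, neg_nonpos]
    positivity
  have hq1 : 1 - Real.exp (-(K : ℝ) ^ 2) ≤ 1 := by linarith [Real.exp_pos (-(K : ℝ) ^ 2)]
  have hpiece : ∀ (b c : Profile k) (i : Fin n), b i ≠ W.piecewise c b i → i ∈ W := by
    intro b c i h
    by_contra hi
    simp [hi] at h
  -- Condition on all directions in `W`: they determine the level of `e` and the paths from the cube
  -- to each label. The middle phase uses only directions off `W`, which are still fresh.
  refine (pr_le_mul_of_splice {m | m.1 ∈ W}
    (F := fun ω' => M ≤ (level ω' e W L).card ∧ ∀ c, CubeReaches ω' W T x y c)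
    (r := (1 - Real.exp (-(K : ℝ) ^ 2)) ^ M) (fun ω' hω' => ?_) fun ω' ω h => ⟨?_, fun c => ?_⟩).trans
    (mul_le_of_le_one_right (by positivity) (pr_le_one _))
  · choose T' hT' hmono using hω'.2
    refine le_trans ?_ (pow_le_pow_of_le_one hq0 hq1 hω'.1)
    refine (pr_mono fun ω h c hc => ?_).trans (pr_forall_not_monoReach_le hK1 hK (level ω' e W L)
      (fun c => W.piecewise c ((T' c).piecewise y x)) (fun c => c) ?_)
    · intro hm
      refine h.2.2 (T' c) (hT' c) ?_
      -- Three phases: the members of `W` move to the label `c`, the others move to their actions in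
      -- `e` (which are those in `c`), and the backward path leads from `c` to `e`.
      refine (MonoReach.reach (t := W.piecewise c ((T' c).piecewise y x)) ?_).trans
        ((MonoReach.reach (t := c) ?_).trans (reach_of_mem_level (W := W) (l := L) ?_))
      · refine (hmono c).congr_of_diff_subset fun m hm => (splice_of_mem ?_ _ _).symm
        exact hpiece _ _ _ hm
      · refine hm.congr_of_diff_subset fun m hm => (splice_of_notMem ?_ _ _).symm
        intro hmW
        have : m.1 ∈ W := hmW
        simp [this] at hm
      · rwa [level_congr_of_dir (ω' := ω') fun m hm =>
          splice_of_mem (S := {m : Fin n × Profile k | m.1 ∈ W}) hm _ _]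
    · intro c hc c' hc' hne
      obtain ⟨j, hj⟩ := Function.ne_iff.1 hne
      have hjW : j ∈ W := by
        by_contra h
        have h1 : c j = e j := by
          by_contra h2
          exact h ((diff_subset_of_mem_level hc).1 (mem_diff.2 h2))
        have h1' : c' j = e j := by
          by_contra h2
          exact h ((diff_subset_of_mem_level hc').1 (mem_diff.2 h2))
        exact hj (h1.trans h1'.symm)
      exact ⟨j, by simp [hjW], by simp [hjW], by simpa [hjW] using hj⟩
  · rw [← level_congr_of_dir (ω := splice {m : Fin n × Profile k | m.1 ∈ W} ω' ω) fun m hm =>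
          splice_of_mem (S := {m : Fin n × Profile k | m.1 ∈ W}) hm _ _]
    exact h.1
  · obtain ⟨T', hT', hm⟩ := h.2.1 c
    refine ⟨T', hT', hm.congr_of_diff_subset fun m hm => splice_of_mem ?_ _ _⟩
    exact hpiece _ _ _ hm

/-- There is a cube of dimension `d` in directions off `W` from no point of which a certain
equilibrium can be reached. -/
def HasTrap (ω : Sample k) (W : Finset (Fin n)) (d : ℕ) : Prop :=
  ∃ (e x y : Profile k) (T : Finset (Fin n)), IsNash ω e ∧ Disjoint W T ∧ T.card = d ∧
    (∀ i ∈ T, y i ≠ x i) ∧ ∀ T' ⊆ T, ¬ Reach (br ω) (T'.piecewise y x) e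

theorem card_profile_mul_prod : (Fintype.card (Profile k) : ℝ) * ∏ i, (1 / (k i : ℝ)) = 1 := by
  simp only [Profile, Fintype.card_pi, Fintype.card_fin]
  push_cast
  rw [← Finset.prod_mul_distrib]
  refine Finset.prod_eq_one fun i _ => mul_one_div_cancel ?_
  exact_mod_cast NeZero.ne (k i)

/-- A trap requires one of three failures: an equilibrium with too small a backward level, a cube
from which some label cannot be attained, or a cube that attains all labels while no completion to
`e` works. The last two are union bounds over two corners of the cube, a label or equilibrium, and
`T`. -/
theorem pr_hasTrap_le {K : ℕ} (hk : ∀ i, 2 ≤ k i) (hK1 : 1 ≤ K) (hK : ∀ i, k i ≤ K)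
    (W : Finset (Fin n)) {d : ℕ} (hd : 20 * (d + 1) ≤ W.card) :
    pr (fun ω : Sample k => HasTrap ω W d) ≤
      d * Real.exp (-((W.card : ℝ) ^ 2 / (10 * K))) +
        2 * ((Fintype.card (Profile k) : ℝ) ^ 3 * 2 ^ n *
          (1 - Real.exp (-(K : ℝ) ^ 2)) ^ 2 ^ d) := by
  classical
  have hq0 : 0 ≤ 1 - Real.exp (-(K : ℝ) ^ 2) := by
    rw [sub_nonneg, Real.exp_le_one_iff, neg_nonpos]
    positivity
  set p := (1 - Real.exp (-(K : ℝ) ^ 2)) ^ 2 ^ d with hp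
  have hp0 : 0 ≤ p := by positivity
  let I := Profile k × Profile k × Profile k × Finset (Fin n)
  have hI : (Fintype.card I : ℝ) = (Fintype.card (Profile k) : ℝ) ^ 3 * 2 ^ n := by
    simp only [I, Fintype.card_prod, Fintype.card_finset, Fintype.card_fin]
    push_cast
    ring
  have h1 := pr_exists_le_card_mul (fun (e : Profile k) (ω : Sample k) =>
    IsNash ω e ∧ (level ω e W (d + 1)).card < 2 ^ d)
    fun e => pr_isNash_and_card_level_lt_le hk hK e W hd
  have h2 := pr_exists_le_card_mul (fun (q : I) (ω : Sample k) =>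
    (Disjoint W q.2.2.2 ∧ q.2.2.2.card = d ∧ ∀ i ∈ q.2.2.2, q.2.1 i ≠ q.1 i) ∧
      ¬ CubeReaches ω W q.2.2.2 q.1 q.2.1 q.2.2.1) (r := p) fun q => by
    by_cases hq : Disjoint W q.2.2.2 ∧ q.2.2.2.card = d ∧ ∀ i ∈ q.2.2.2, q.2.1 i ≠ q.1 i
    · refine (pr_mono fun ω h => h.2).trans ?_
      rw [hp, ← hq.2.1]
      exact pr_not_cubeReaches_le hK1 hK hq.1 hq.2.2 _
    · exact (pr_mono (F := fun _ => False) fun ω h => hq h.1).trans (pr_false.trans_le hp0)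
  have h3 := pr_exists_le_card_mul (fun (q : I) (ω : Sample k) =>
    2 ^ d ≤ (level ω q.2.2.1 W (d + 1)).card ∧ (∀ c, CubeReaches ω W q.2.2.2 q.1 q.2.1 c) ∧
      ∀ T' ⊆ q.2.2.2, ¬ Reach (br ω) (T'.piecewise q.2.1 q.1) q.2.2.1) (r := p)
    fun q => pr_not_reach_le hK1 hK W _ _ _ _ _ _
  -- The number of candidates `e` cancels against the probability that `e` is an equilibrium.
  have h4 : (Fintype.card (Profile k) : ℝ) *
      (d * (Real.exp (-((W.card : ℝ) ^ 2 / (10 * K))) * ∏ i, (1 / (k i : ℝ)))) =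
      d * Real.exp (-((W.card : ℝ) ^ 2 / (10 * K))) := by
    linear_combination (d * Real.exp (-((W.card : ℝ) ^ 2 / (10 * K)))) *
      card_profile_mul_prod (k := k)
  rw [h4] at h1
  rw [hI] at h2 h3
  rw [two_mul]
  refine le_trans (pr_mono fun ω h => ?_)
    ((pr_or_le _ _).trans (add_le_add h1 ((pr_or_le _ _).trans (add_le_add h2 h3))))
  obtain ⟨e, x, y, T, he, hWT, hT, hxy, hr⟩ := h
  by_cases hlev : (level ω e W (d + 1)).card < 2 ^ d
  · exact Or.inl ⟨e, he, hlev⟩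
  by_cases hc : ∀ c, CubeReaches ω W T x y c
  · exact Or.inr (Or.inr ⟨(x, y, e, T), not_lt.1 hlev, hc, hr⟩)
  · push Not at hc
    obtain ⟨c, hc⟩ := hc
    exact Or.inr (Or.inl ⟨(x, y, c, T), ⟨hWT, hT, hxy⟩, hc⟩)

/-- The players who do not play a best-response. -/
def deviators (ω : Sample k) (a : Profile k) : Finset (Fin n) :=
  univ.filter fun i => br ω i a ≠ a i

theorem mem_deviators {ω : Sample k} {a : Profile k} {i : Fin n} :
    i ∈ deviators ω a ↔ br ω i a ≠ a i := by simp [deviators]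

/-- Two profiles that differ in the action of one player both have at most `m` deviators. -/
def HasQuietPair (ω : Sample k) (m : ℕ) : Prop :=
  ∃ (a : Profile k) (i : Fin n) (x : Fin (k i)), x ≠ a i ∧ (deviators ω a).card ≤ m ∧
    (deviators ω (update a i x)).card ≤ m

theorem prod_compl_le {K : ℕ} (hK : ∀ i, k i ≤ K) (D : Finset (Fin n)) :
    ∏ i ∈ Dᶜ, (1 / (k i : ℝ)) ≤ (∏ i, (1 / (k i : ℝ))) * K ^ D.card := by
  have h0 : ∀ i, (k i : ℝ) ≠ 0 := fun i => by exact_mod_cast NeZero.ne (k i)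
  have h1 : ∏ i ∈ D, (k i : ℝ) ≤ K ^ D.card := by
    rw [← Finset.prod_const]
    exact Finset.prod_le_prod (fun _ _ => by positivity) fun i _ => by exact_mod_cast hK i
  have h2 : (∏ i ∈ D, (1 / (k i : ℝ))) * ∏ i ∈ D, (k i : ℝ) = 1 := by
    rw [← Finset.prod_mul_distrib]
    exact Finset.prod_eq_one fun i _ => one_div_mul_cancel (h0 i)
  have h3 := Finset.prod_compl_mul_prod D fun i => (1 / (k i : ℝ))
  calc ∏ i ∈ Dᶜ, (1 / (k i : ℝ)) = (∏ i, (1 / (k i : ℝ))) * ∏ i ∈ D, (k i : ℝ) := by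
        rw [← h3, mul_assoc, h2, mul_one]
    _ ≤ _ := by gcongr

/-- The two profiles share only their line in direction `i`, which is left out as `i` belongs to `D`
and `D'`. All the other conditions concern distinct lines. -/
theorem pr_forall_notMem_br_eq_le {K : ℕ} (hK : ∀ i, k i ≤ K) (a : Profile k) {i : Fin n}
    {x : Fin (k i)} (hx : x ≠ a i) {m : ℕ} {D D' : Finset (Fin n)} (hi : i ∈ D) (hi' : i ∈ D')
    (hD : D.card = m) (hD' : D'.card = m) :
    pr (fun ω : Sample k => (∀ j ∉ D, br ω j a = a j) ∧
      ∀ j ∉ D', br ω j (update a i x) = update a i x j) ≤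
      ((∏ i, (1 / (k i : ℝ))) * K ^ m) ^ 2 := by
  classical
  have hdisj : Disjoint (Dᶜ.map (line a)) (D'ᶜ.map (line (update a i x))) := by
    rw [Finset.disjoint_left]
    simp only [Finset.mem_map, mem_compl, not_exists, not_and]
    rintro l ⟨j, hj, rfl⟩ j' hj' h
    obtain ⟨h1, h2⟩ := Prod.ext_iff.1 h
    change j' = j at h1
    subst h1
    have hji : i ≠ j' := by rintro rfl; exact hj hi
    have h3 : update (update a i x) j' 0 i = update a j' 0 i := congrFun h2 i
    rw [update_of_ne hji, update_of_ne hji, update_self] at h3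
    exact hx h3
  have h := pr_forall_mem_eq (α := fun l : Fin n × Profile k => Fin (k l.1))
    (Dᶜ.map (line a) ∪ D'ᶜ.map (line (update a i x))) (fun l => a l.1)
  rw [Finset.prod_union hdisj, Finset.prod_map, Finset.prod_map] at h
  simp only [Fintype.card_fin] at h
  rw [sq]
  refine (pr_mono fun ω hω l hl => ?_).trans (h.trans_le (mul_le_mul ((prod_compl_le hK D).trans_eq
    (by rw [hD])) ((prod_compl_le hK D').trans_eq (by rw [hD'])) ?_ ?_))
  · rw [mem_union, Finset.mem_map, Finset.mem_map] at hl
    rcases hl with ⟨j, hj, rfl⟩ | ⟨j, hj, rfl⟩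
    · exact hω.1 j (mem_compl.1 hj)
    · have hj := mem_compl.1 hj
      have hji : j ≠ i := by rintro rfl; exact hj hi'
      exact (hω.2 j hj).trans (update_of_ne hji _ _)
  · exact Finset.prod_nonneg fun _ _ => by positivity
  · exact mul_nonneg (Finset.prod_nonneg fun _ _ => by positivity) (by positivity)

/-- Two adjacent profiles that are both nearly equilibria cost about the square of `∏ i, 1 / k i`,
while the choice of the first profile gives back only one such factor. -/
theorem pr_hasQuietPair_le {K : ℕ} (hK : ∀ i, k i ≤ K) {m : ℕ} (hm : m + 1 ≤ n) :
    pr (fun ω : Sample k => HasQuietPair ω m) ≤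
      (∏ i, (1 / (k i : ℝ))) * ((n : ℝ) * K * (n ^ (m + 1) * K ^ (m + 1)) ^ 2) := by
  classical
  set p : ℝ := ∏ i, (1 / (k i : ℝ)) with hp
  have hp0 : 0 ≤ p := Finset.prod_nonneg fun _ _ => by positivity
  set r : ℝ := (n ^ (m + 1)) ^ 2 * (p * K ^ (m + 1)) ^ 2 with hr
  have hr0 : 0 ≤ r := by positivity
  have hfix : ∀ (a : Profile k) (i : Fin n) (x : Fin (k i)),
      pr (fun ω : Sample k => x ≠ a i ∧ (deviators ω a).card ≤ m ∧
        (deviators ω (update a i x)).card ≤ m) ≤ r := by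
    intro a i x
    by_cases hx : x = a i
    · exact (pr_mono (F := fun _ => False) fun ω h => h.1 hx).trans (pr_false.trans_le hr0)
    -- At most `m` deviators together with `i` are enlarged to sets of exactly `m + 1` players; `m +
    -- 1` rather than `m` makes room for `i`.
    let 𝓓 := (powersetCard (m + 1) (univ : Finset (Fin n))) ×ˢ
      (powersetCard (m + 1) (univ : Finset (Fin n)))
    have hcard : (𝓓.card : ℝ) ≤ (n ^ (m + 1)) ^ 2 := by
      rw [card_product, card_powersetCard, card_univ, Fintype.card_fin, sq]
      have := Nat.choose_le_pow n (m + 1)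
      exact_mod_cast Nat.mul_le_mul this this
    have hex : ∀ b : Profile k, ∀ ω : Sample k, (deviators ω b).card ≤ m →
        ∃ D ∈ powersetCard (m + 1) (univ : Finset (Fin n)), i ∈ D ∧ ∀ j ∉ D, br ω j b = b j := by
      intro b ω hb
      obtain ⟨D, hD, -, hcard⟩ := Finset.exists_subsuperset_card_eq
        (subset_univ (insert i (deviators ω b)))
        ((card_insert_le _ _).trans (Nat.succ_le_succ hb)) (by simpa using hm)
      refine ⟨D, by simp [hcard], hD (mem_insert_self _ _), fun j hj => ?_⟩
      by_contra hne
      exact hj (hD (mem_insert_of_mem (mem_deviators.2 hne)))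
    refine (pr_mono (F := fun ω => ∃ q ∈ 𝓓, (i ∈ q.1 ∧ i ∈ q.2) ∧ (∀ j ∉ q.1, br ω j a = a j) ∧
      ∀ j ∉ q.2, br ω j (update a i x) = update a i x j) fun ω h => ?_).trans
      ((pr_exists_mem_le _ _).trans ((Finset.sum_le_card_nsmul _ _ ((p * K ^ (m + 1)) ^ 2)
        fun q hq => ?_).trans ?_))
    · obtain ⟨D, hD, hiD, h1⟩ := hex _ ω h.2.1
      obtain ⟨D', hD', hiD', h2⟩ := hex _ ω h.2.2
      exact ⟨(D, D'), mem_product.2 ⟨hD, hD'⟩, ⟨hiD, hiD'⟩, h1, h2⟩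
    · by_cases hi : i ∈ q.1 ∧ i ∈ q.2
      · obtain ⟨h1, h2⟩ := mem_product.1 hq
        exact (pr_mono fun ω h => h.2).trans (pr_forall_notMem_br_eq_le hK a hx hi.1 hi.2
          (mem_powersetCard.1 h1).2 (mem_powersetCard.1 h2).2)
      · exact (pr_mono (F := fun _ => False) fun ω h => hi h.1).trans
          (pr_false.trans_le (by positivity))
    · rw [nsmul_eq_mul, hr]
      gcongr
  have h1 : pr (fun ω : Sample k => HasQuietPair ω m) ≤
      Fintype.card (Profile k) * (Fintype.card (Fin n) * (K * r)) := by
    refine pr_exists_le_card_mul _ fun a => pr_exists_le_card_mul _ fun i =>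
      (pr_exists_le_card_mul _ fun x => hfix a i x).trans ?_
    rw [Fintype.card_fin]
    gcongr
    exact hK i
  refine h1.trans_eq ?_
  rw [Fintype.card_fin, hr]
  linear_combination (p * n * K * ((n ^ (m + 1)) ^ 2 * (K ^ (m + 1)) ^ 2)) *
    card_profile_mul_prod (k := k)

/-- Unless there is a trap or a quiet pair, every equilibrium can be reached from every profile that
is not an equilibrium. -/
theorem exists_reach_isNash {ω : Sample k} {W : Finset (Fin n)} {d : ℕ} (h1 : ¬ HasTrap ω W d)
    (h2 : ¬ HasTrap ω Wᶜ d) (h3 : ¬ HasQuietPair ω (2 * d)) (hne : ∃ e, IsNash ω e)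
    (a : Profile k) : ∃ e, IsNash ω e ∧ Reach (br ω) a e := by
  classical
  obtain ⟨e, he⟩ := hne
  have hcube : ∀ x : Profile k, 2 * d < (deviators ω x).card → Reach (br ω) x e := by
    intro x hx
    -- The cube is spanned by `x` and its simultaneous best-responses, so inertia reaches each of
    -- its points in a single move.
    have key : ∀ U : Finset (Fin n), ¬ HasTrap ω U d → d ≤ (deviators ω x \ U).card →
        Reach (br ω) x e := by
      intro U hU hcard
      obtain ⟨T, hT, hTd⟩ := Finset.exists_subset_card_eq hcard
      by_contra hnot
      refine hU ⟨e, x, fun i => br ω i x, T, he, ?_, hTd, fun i hi => ?_, fun T' hT' hr => ?_⟩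
      · exact disjoint_of_subset_right hT disjoint_sdiff
      · exact mem_deviators.1 (mem_sdiff.1 (hT hi)).1
      · refine hnot (Relation.ReflTransGen.head (fun i => ?_) hr)
        by_cases hi : i ∈ T'
        · right; simp [hi]
        · left; simp [hi]
    have hsplit := card_sdiff_add_card_inter (deviators ω x) W
    have hc : deviators ω x \ Wᶜ = deviators ω x ∩ W := by
      ext; simp
    rcases Nat.lt_or_ge (deviators ω x \ W).card d with h | h
    · exact key Wᶜ h2 (by rw [hc]; omega)
    · exact key W h1 h
  by_cases hd : 2 * d < (deviators ω a).card
  · exact ⟨e, he, hcube a hd⟩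
  by_cases hN : IsNash ω a
  · exact ⟨a, hN, .refl⟩
  unfold IsNash at hN
  push Not at hN
  obtain ⟨i, hi⟩ := hN
  -- A single best-response leads to a neighbour, which must have more than `2 * d` deviators in the
  -- absence of a quiet pair.
  refine ⟨e, he, .head (move_update (br ω) a i) (hcube _ ?_)⟩
  by_contra hlt
  exact h3 ⟨a, i, _, hi, not_lt.1 hd, not_lt.1 hlt⟩

end Connectivity

/-! ### Almost sure absorption -/

section Convergence

open MeasureTheory ProbabilityTheory
open scoped ENNReal

variable {n : ℕ} {k : Fin n → ℕ}

theorem mix_apply {α : Type} [Fintype α] [DecidableEq α] (p : Set.Ioo (0 : ℝ) 1) (x y z : α) :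
    mix p x y z = (if z = x then ENNReal.ofReal p else 0) +
      (if z = y then ENNReal.ofReal (1 - p) else 0) := by
  rw [mix, PMF.ofFintype_apply]

theorem mix_ne_zero {α : Type} [Fintype α] [DecidableEq α] (p : Set.Ioo (0 : ℝ) 1) {x y z : α}
    (h : z = y ∨ z = x) : mix p x y z ≠ 0 := by
  rw [mix_apply]
  rcases h with rfl | rfl
  · simp [p.2.2]
  · simp [p.2.1]

theorem mix_self {α : Type} [Fintype α] [DecidableEq α] (p : Set.Ioo (0 : ℝ) 1) (x : α) :
    mix p x x x = 1 := by
  rw [mix_apply, if_pos rfl, if_pos rfl, ← ENNReal.ofReal_add p.2.1.le (sub_nonneg.2 p.2.2.le),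
    add_sub_cancel, ENNReal.ofReal_one]

/-- The law of the next profile under the best-response dynamic with inertia. -/
def transition (p : Fin n → Set.Ioo (0 : ℝ) 1) (g : GenericGame k) (x : Profile k) :
    Measure (Profile k) :=
  Measure.pi fun i => (mix (p i) (responses g.1 i x) (x i)).toMeasure

instance (p : Fin n → Set.Ioo (0 : ℝ) 1) (g : GenericGame k) (x : Profile k) :
    IsProbabilityMeasure (transition p g x) :=
  inferInstanceAs (IsProbabilityMeasure (Measure.pi _))

theorem transition_singleton (p : Fin n → Set.Ioo (0 : ℝ) 1) (g : GenericGame k)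
    (x b : Profile k) :
    transition p g x {b} = ∏ i, mix (p i) (responses g.1 i x) (x i) (b i) := by
  rw [transition, Measure.pi_singleton]
  refine Finset.prod_congr rfl fun i _ => ?_
  rw [PMF.toMeasure_apply_singleton _ _ (measurableSet_singleton _)]

theorem transition_ne_zero (p : Fin n → Set.Ioo (0 : ℝ) 1) (g : GenericGame k) {x b : Profile k}
    (h : Move (responses g.1) x b) : transition p g x {b} ≠ 0 := by
  rw [transition_singleton, Finset.prod_ne_zero_iff]
  exact fun i _ => mix_ne_zero _ (h i)

theorem transition_compl_eq_zero (p : Fin n → Set.Ioo (0 : ℝ) 1) (g : GenericGame k)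
    {e : Profile k} (he : g.1.IsPureNash e) : transition p g e {e}ᶜ = 0 := by
  rw [prob_compl_eq_zero_iff (measurableSet_singleton e), transition_singleton]
  refine Finset.prod_eq_one fun i _ => ?_
  rw [(g.2.isPureNash_iff e).1 he i, mix_self]

theorem measurableSet_play_eq (t : ℕ) (x : Profile k) :
    MeasurableSet {a : ℕ → Profile k | a t = x} := by
  have h : Measurable fun a : ℕ → Profile k => a t := measurable_pi_apply t
  exact h (measurableSet_singleton x)

/-- The Markov property. -/
theorem play_eq_mul (p : Fin n → Set.Ioo (0 : ℝ) 1) (g : GenericGame k) (a₀ : Profile k) (t : ℕ)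
    (x : Profile k) (s : Set (Profile k)) :
    (bestResponseWithInertia k p).play g a₀ {a | a t = x ∧ a (t + 1) ∈ s} =
      (bestResponseWithInertia k p).play g a₀ {a | a t = x} * transition p g x s := by
  set D := bestResponseWithInertia k p
  have hs : MeasurableSet s := s.toFinite.measurableSet
  have hlast : MeasurableSet {h : History k t | h.last = x} := by
    have h : Measurable fun h : History k t => h.last := measurable_pi_apply _
    exact h (measurableSet_singleton x)
  have h1 := Kernel.partialTraj_compProd_eq_map_traj (X := fun _ => Profile k) (κ := D.step g) (Nat.zero_le t)
    (x₀ := fun _ => a₀)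
  have hmeas : Measurable fun a : ℕ → Profile k =>
      ((Preorder.frestrictLe t a : History k t), a (t + 1)) := by fun_prop
  have h2 : D.play g a₀ {a | a t = x ∧ a (t + 1) ∈ s} =
      (D.play g a₀).map (fun a => ((Preorder.frestrictLe t a : History k t), a (t + 1)))
        ({h : History k t | h.last = x} ×ˢ s) := by
    rw [Measure.map_apply hmeas (hlast.prod hs)]
    rfl
  have h3 : D.play g a₀ {a | a t = x} =
      Kernel.partialTraj (X := fun _ => Profile k) (D.step g) 0 t (fun _ => a₀) {h : History k t | h.last = x} := by
    rw [← Kernel.traj_map_frestrictLe_apply, Measure.map_apply (by fun_prop) hlast]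
    rfl
  rw [h2, h3]
  refine (congrArg (fun m => m ({h : History k t | h.last = x} ×ˢ s)) h1.symm).trans ?_
  rw [Measure.compProd_apply_prod hlast hs,
    setLIntegral_congr_fun (g := fun _ => transition p g x s) hlast ?_, setLIntegral_const,
    mul_comm]
  intro h hh
  have hh : h.last = x := hh
  change transition p g h.last s = transition p g x s
  rw [hh]

/-- Non-equilibria that lead to an equilibrium have finitely many expected visits, by backward
induction along the path. If the next state `b` is absorbing, visits to `x` feed its increasing
occupation probability, which is at most 1; otherwise they are bounded by a multiple of the visits
to `b`. -/
theorem tsum_play_ne_top (p : Fin n → Set.Ioo (0 : ℝ) 1) (g : GenericGame k) (a₀ : Profile k)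
    {x e : Profile k} (he : g.1.IsPureNash e) (hr : Reach (responses g.1) x e) :
    g.1.IsPureNash x ∨ ∑' t, (bestResponseWithInertia k p).play g a₀ {a | a t = x} ≠ ∞ := by
  set μ := (bestResponseWithInertia k p).play g a₀
  have : IsProbabilityMeasure μ :=
    inferInstanceAs (IsProbabilityMeasure (Kernel.traj _ _ _))
  induction hr using Relation.ReflTransGen.head_induction_on with
  | refl => exact Or.inl he
  | @head x b hxb _ ih =>
    by_cases hx : g.1.IsPureNash x
    · exact Or.inl hx
    refine Or.inr ?_
    set q := transition p g x {b}
    have hq : q ≠ 0 := transition_ne_zero p g hxb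
    suffices h : ∑' t, μ {a | a t = x} * q ≠ ∞ by
      rw [ENNReal.tsum_mul_right] at h
      intro h'
      rw [h', ENNReal.top_mul hq] at h
      exact h rfl
    have hstep : ∀ t y, μ {a | a t = y} * transition p g y {b} =
        μ {a | a t = y ∧ a (t + 1) = b} := fun t y => (play_eq_mul p g a₀ t y {b}).symm
    by_cases hb : g.1.IsPureNash b
    · have hbb : transition p g b {b} = 1 :=
        (prob_compl_eq_zero_iff (measurableSet_singleton b)).1 (transition_compl_eq_zero p g hb)
      have hinc : ∀ t, μ {a | a t = b} + μ {a | a t = x} * q ≤ μ {a | a (t + 1) = b} := by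
        intro t
        rw [hstep, ← mul_one (μ {a | a t = b}), ← hbb, hstep, ← measure_union]
        · exact measure_mono fun a ha => ha.elim And.right And.right
        · refine Set.disjoint_left.2 fun a h h' => hx ?_
          rw [← h'.1, h.1]
          exact hb
        · exact (measurableSet_play_eq t x).inter (measurableSet_play_eq (t + 1) b)
      have hsum : ∀ N, ∑ t ∈ range N, μ {a | a t = x} * q ≤ μ {a | a N = b} := by
        intro N
        induction N with
        | zero => simp
        | succ N ihN =>
          rw [Finset.sum_range_succ]
          exact (add_le_add_left ihN _).trans (hinc N)
      refine ((ENNReal.tsum_le_of_sum_range_le fun N => (hsum N).trans prob_le_one).trans_lt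
        ENNReal.one_lt_top).ne
    · refine ne_top_of_le_ne_top (ih.resolve_left hb) ?_
      refine le_trans (ENNReal.tsum_le_tsum fun t => ?_)
        (ENNReal.tsum_comp_le_tsum_of_injective Nat.succ_injective
          fun t => μ {a | a t = b})
      rw [hstep]
      exact measure_mono fun a ha => ha.2

/-- If an equilibrium can be reached from every profile, then play converges to an equilibrium. -/
theorem convergesToPureNash_of_reach (p : Fin n → Set.Ioo (0 : ℝ) 1) (g : GenericGame k)
    (h : ∀ a, ∃ e, g.1.IsPureNash e ∧ Reach (responses g.1) a e) :
    (bestResponseWithInertia k p).ConvergesToPureNash g := by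
  intro a₀
  set μ := (bestResponseWithInertia k p).play g a₀
  have h1 : ∀ᵐ a ∂μ, ∀ t, ∀ e : Profile k, g.1.IsPureNash e → a t = e → a (t + 1) = e := by
    rw [ae_all_iff]
    intro t
    rw [ae_all_iff]
    intro e
    by_cases he : g.1.IsPureNash e
    · have h0 : μ {a | a t = e ∧ a (t + 1) ∈ ({e} : Set (Profile k))ᶜ} = 0 := by
        rw [play_eq_mul, transition_compl_eq_zero p g he, mul_zero]
      filter_upwards [measure_eq_zero_iff_ae_notMem.1 h0] with a ha _ hat
      by_contra hne
      exact ha ⟨hat, hne⟩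
    · exact Filter.Eventually.of_forall fun a h' => absurd h' he
  have h2 : ∀ᵐ a ∂μ, ∀ x : Profile k, ¬ g.1.IsPureNash x → ∀ᶠ t in Filter.atTop, a t ≠ x := by
    rw [ae_all_iff]
    intro x
    by_cases hx : g.1.IsPureNash x
    · exact Filter.Eventually.of_forall fun a h' => absurd hx h'
    · obtain ⟨e, he, hr⟩ := h x
      -- First Borel–Cantelli lemma.
      have := ae_eventually_notMem ((tsum_play_ne_top p g a₀ he hr).resolve_left hx)
      filter_upwards [this] with a ha _
      exact ha
  filter_upwards [h1, h2] with a ha1 ha2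
  have h3 : ∀ᶠ t in Filter.atTop, ∀ x : Profile k, ¬ g.1.IsPureNash x → a t ≠ x := by
    rw [Filter.eventually_all]
    intro x
    by_cases hx : g.1.IsPureNash x
    · exact Filter.Eventually.of_forall fun t h' => absurd hx h'
    · exact (ha2 x hx).mono fun t ht _ => ht
  obtain ⟨T, hT⟩ := h3.exists
  have hTN : g.1.IsPureNash (a T) := by
    by_contra hcon
    exact hT _ hcon rfl
  refine ⟨T, a T, hTN, fun t ht => ?_⟩
  induction t, ht using Nat.le_induction with
  | base => rfl
  | succ t _ ih => exact ha1 t _ hTN ih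

end Convergence

/-! ### Existence of an equilibrium with probability at least 1/2 -/

section SecondMoment

variable {n : ℕ} {k : Fin n → ℕ} [∀ i, NeZero (k i)]

/-- Distinct equilibria never share a line, since the response on it is unique; profiles without a
common line involve independent responses. -/
theorem pr_isNash_and_isNash_le {a b : Profile k} (hab : a ≠ b) :
    pr (fun ω : Sample k => IsNash ω a ∧ IsNash ω b) ≤ (∏ i, (1 / (k i : ℝ))) ^ 2 := by
  classical
  by_cases h : ∃ i, update a i 0 = update b i 0
  · obtain ⟨i, hi⟩ := h
    refine (pr_mono (F := fun _ => False) fun ω hω => hab ?_).trans (pr_false.trans_le (sq_nonneg _))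
    have h1 : a i = b i := by rw [← hω.1 i, ← hω.2 i, br, br, hi]
    funext j
    by_cases hj : j = i
    · subst hj; exact h1
    · simpa [hj] using congrFun hi j
  push Not at h
  have hdisj : Disjoint (univ.map (line a)) (univ.map (line b)) := by
    rw [Finset.disjoint_left]
    simp only [Finset.mem_map, mem_univ, true_and, not_exists]
    rintro l ⟨i, rfl⟩ j hj
    obtain ⟨h1, h2⟩ := Prod.ext_iff.1 hj
    change j = i at h1
    subst h1
    exact h j h2.symm
  have hpr := pr_forall_mem_eq (α := fun l : Fin n × Profile k => Fin (k l.1))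
    (univ.map (line a) ∪ univ.map (line b))
    (fun l => if l ∈ univ.map (line a) then a l.1 else b l.1)
  rw [Finset.prod_union hdisj, Finset.prod_map, Finset.prod_map] at hpr
  simp only [Fintype.card_fin] at hpr
  rw [sq]
  refine (pr_mono fun ω hω l hl => ?_).trans_eq hpr
  by_cases hla : l ∈ univ.map (line a)
  · rw [if_pos hla]
    obtain ⟨i, -, rfl⟩ := Finset.mem_map.1 hla
    exact hω.1 i
  · rw [if_neg hla]
    obtain ⟨i, -, rfl⟩ := Finset.mem_map.1 ((mem_union.1 hl).resolve_left hla)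
    exact hω.2 i

/-- The number `N` of equilibria has mean 1 and second moment at most 2. As `(N - 1) * (N - 2) ≥ 0`
for integers, the indicator of `N ≥ 1` is at least `(3 * N - N ^ 2) / 2`. -/
theorem half_le_pr_exists_isNash : 1 / 2 ≤ pr (fun ω : Sample k => ∃ e, IsNash ω e) := by
  classical
  set p : ℝ := ∏ i, (1 / (k i : ℝ)) with hp
  set A : ℝ := (Fintype.card (Profile k) : ℝ) with hA
  have hAp : A * p = 1 := card_profile_mul_prod
  let X : Profile k → Sample k → ℝ := fun a => {ω | IsNash ω a}.indicator fun _ => 1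
  let N : Sample k → ℝ := fun ω => ∑ a, X a ω
  have hN : ∀ ω, N ω = ((univ.filter fun a => IsNash ω a).card : ℝ) := by
    intro ω
    simp [N, X, Set.indicator, Finset.sum_boole]
  have hEN : (𝔼 ω, N ω) = 1 := by
    rw [Finset.expect_sum_comm]
    have : ∀ a : Profile k, (𝔼 ω, X a ω) = p := fun a => pr_isNash a
    simp only [this, Finset.sum_const, card_univ, nsmul_eq_mul]
    exact hAp
  have hEN2 : (𝔼 ω, N ω ^ 2) ≤ 2 := by
    have h1 : ∀ ω, N ω ^ 2 = ∑ a, ∑ b, X a ω * X b ω := fun ω => by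
      rw [sq, Finset.sum_mul_sum]
    have h2 : ∀ a b : Profile k, (𝔼 ω, X a ω * X b ω) ≤ (if a = b then p else 0) + p ^ 2 := by
      intro a b
      have h3 : (𝔼 ω, X a ω * X b ω) = pr (fun ω => IsNash ω a ∧ IsNash ω b) := by
        refine Finset.expect_congr rfl fun ω _ => ?_
        by_cases ha : IsNash ω a <;> by_cases hb : IsNash ω b <;> simp [X, Set.indicator, ha, hb]
      rw [h3]
      by_cases hab : a = b
      · subst hab
        rw [if_pos rfl]
        refine (pr_mono fun ω h => h.1).trans ?_
        rw [pr_isNash]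
        nlinarith
      · rw [if_neg hab, zero_add]
        exact pr_isNash_and_isNash_le hab
    simp only [h1]
    rw [Finset.expect_sum_comm]
    simp only [Finset.expect_sum_comm]
    refine (Finset.sum_le_sum fun a _ => Finset.sum_le_sum fun b _ => h2 a b).trans ?_
    simp only [Finset.sum_add_distrib, Finset.sum_ite_eq, mem_univ, if_true, Finset.sum_const,
      card_univ, nsmul_eq_mul]
    rw [← hA]
    nlinarith
  have key : (𝔼 ω, (3 * N ω - N ω ^ 2) / 2) ≤ pr (fun ω : Sample k => ∃ e, IsNash ω e) := by
    refine Finset.expect_le_expect fun ω _ => ?_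
    rw [hN]
    by_cases h : ∃ e, IsNash ω e
    · simp only [Set.indicator, Set.mem_ofPred_eq, h, if_true]
      set m := (univ.filter fun a => IsNash ω a).card
      rcases Nat.lt_or_ge m 2 with hm | hm
      · have : (m : ℝ) ≤ 1 := by exact_mod_cast Nat.lt_succ_iff.1 hm
        nlinarith
      · have : (2 : ℝ) ≤ m := by exact_mod_cast hm
        nlinarith
    · have h0 : (univ.filter fun a => IsNash ω a) = ∅ := by
        rw [Finset.filter_eq_empty_iff]
        exact fun a _ ha => h ⟨a, ha⟩
      simp [h0, h]
  rw [← Finset.expect_div, Finset.expect_sub_distrib, ← Finset.mul_expect, hEN] at key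
  linarith

end SecondMoment

/-! ### Numerical estimates -/

section Estimates

variable {n : ℕ} {k : Fin n → ℕ}

theorem log_sq_le_sqrt {x : ℝ} (hx : 1 ≤ x) : Real.log x ^ 2 ≤ 16 * Real.sqrt x := by
  have h1 : Real.log x = 4 * Real.log (Real.sqrt (Real.sqrt x)) := by
    rw [Real.log_sqrt (Real.sqrt_nonneg x), Real.log_sqrt (by linarith)]
    ring
  have h0 : 0 ≤ Real.log x := Real.log_nonneg hx
  have h2 : Real.log x ≤ 4 * Real.sqrt (Real.sqrt x) := by
    rw [h1]
    have := Real.log_le_self (Real.sqrt_nonneg (Real.sqrt x))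
    linarith
  calc Real.log x ^ 2 ≤ (4 * Real.sqrt (Real.sqrt x)) ^ 2 := by gcongr
    _ = 16 * Real.sqrt x := by rw [mul_pow, Real.sq_sqrt (Real.sqrt_nonneg x)]; norm_num

theorem clog_two_le (hn : 2 ≤ n) : (Nat.clog 2 n : ℝ) ≤ 1 + 2 * Real.log n := by
  have h1 : 2 ^ (Nat.clog 2 n).pred < n := Nat.pow_pred_clog_lt_self one_lt_two (by omega)
  have h2 : ((Nat.clog 2 n).pred : ℝ) * Real.log 2 ≤ Real.log n := by
    rw [← Real.log_pow]
    refine Real.log_le_log (by positivity) ?_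
    exact_mod_cast h1.le
  have h3 : (Nat.clog 2 n : ℝ) ≤ (Nat.clog 2 n).pred + 1 := by
    have : Nat.clog 2 n ≤ (Nat.clog 2 n).pred + 1 := by
      rw [Nat.pred_eq_sub_one]; omega
    exact_mod_cast this
  have h4 := Real.log_two_gt_d9
  have h5 : (0 : ℝ) ≤ (Nat.clog 2 n).pred := by positivity
  nlinarith

/-- The dimension of the cubes from which monotone paths are attempted. -/
def cubeDim (n K : ℕ) : ℕ := 2 * K ^ 2 + 3 * Nat.clog 2 n

/-- The size condition with `K ≥ 2` already forces `n` to be huge, so small `n` need no treatment.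
-/
theorem large_of_le {K : ℕ} (hn : 2 ≤ n) (hK2 : 2 ≤ K)
    (hK : (K : ℝ) ≤ 1 / 10 ^ 4 * Real.sqrt (n / Real.log n)) :
    (100000000 : ℝ) ≤ n ∧ 10 ≤ Real.log n ∧ (8 * cubeDim n K + 6) * Real.log n ≤ (n : ℝ) / 4 := by
  have hn' : (2 : ℝ) ≤ n := by exact_mod_cast hn
  have hlog2 := Real.log_two_gt_d9
  have hlog : Real.log 2 ≤ Real.log n := Real.log_le_log (by norm_num) hn'
  have hlog0 : 0 < Real.log n := by linarith
  have hK2' : (2 : ℝ) ≤ K := by exact_mod_cast hK2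
  have hsq : (K : ℝ) ^ 2 * Real.log n ≤ 1 / 10 ^ 8 * (n : ℝ) := by
    have h1 : (K : ℝ) ^ 2 ≤ (1 / 10 ^ 4 * Real.sqrt (n / Real.log n)) ^ 2 := by gcongr
    rw [mul_pow, Real.sq_sqrt (by positivity)] at h1
    calc (K : ℝ) ^ 2 * Real.log n ≤ ((1 / 10 ^ 4) ^ 2 * (n / Real.log n)) * Real.log n := by
          gcongr
      _ = (1 / 10 ^ 4) ^ 2 * (n : ℝ) := by rw [mul_assoc, div_mul_cancel₀ _ hlog0.ne']
      _ = 1 / 10 ^ 8 * (n : ℝ) := by norm_num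
  have hn8 : (100000000 : ℝ) ≤ n := by nlinarith
  have hlog10 : 10 ≤ Real.log n := by
    rw [Real.le_log_iff_exp_le (by linarith)]
    have h1 : Real.exp 10 = Real.exp 1 ^ 10 := by rw [← Real.exp_nat_mul]; norm_num
    have h2 : Real.exp 1 ^ 10 ≤ 3 ^ 10 := by
      gcongr
      linarith [Real.exp_one_lt_d9]
    rw [h1]
    refine h2.trans (le_trans ?_ hn8)
    norm_num
  refine ⟨hn8, hlog10, ?_⟩
  have h1 := clog_two_le hn
  have h2 : Real.log n ^ 2 ≤ (n : ℝ) / 625 := by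
    refine (log_sq_le_sqrt (by linarith)).trans ?_
    have h3 : (10 : ℝ) ^ 4 ≤ Real.sqrt n := Real.le_sqrt_of_sq_le (by linarith)
    have h4 : Real.sqrt n * Real.sqrt n = n := Real.mul_self_sqrt (by linarith)
    nlinarith
  have h3 : (cubeDim n K : ℝ) = 2 * (K : ℝ) ^ 2 + 3 * Nat.clog 2 n := by
    rw [cubeDim]; push_cast; ring
  rw [h3]
  have h4 : (Nat.clog 2 n : ℝ) * Real.log n ≤ (1 + 2 * Real.log n) * Real.log n := by gcongr
  nlinarith

/-- This is the reason for the form of `cubeDim`: `2 ^ (2 * K ^ 2)` outweighs the success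
probability `exp (-K ^ 2)` of one attempt, and the logarithmic term leaves `n ^ 3` expected
successes. -/
theorem exp_mul_two_pow_ge (n K : ℕ) :
    (n : ℝ) ^ 3 ≤ Real.exp (-(K : ℝ) ^ 2) * 2 ^ cubeDim n K := by
  have h1 : (n : ℝ) ≤ 2 ^ Nat.clog 2 n := by exact_mod_cast Nat.le_pow_clog one_lt_two n
  have h2 : Real.exp ((K : ℝ) ^ 2) ≤ 2 ^ (2 * K ^ 2) := by
    have : Real.exp ((K : ℝ) ^ 2) = Real.exp 1 ^ (K ^ 2) := by
      rw [← Real.exp_nat_mul]; push_cast; ring_nf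
    rw [this, pow_mul]
    gcongr
    linarith [Real.exp_one_lt_d9]
  rw [cubeDim, pow_add, Real.exp_neg, pow_mul' (2 : ℝ) 3, ← div_eq_inv_mul,
    le_div_iff₀ (Real.exp_pos _), mul_comm]
  gcongr

theorem card_profile_le {K : ℕ} (hK : ∀ i, k i ≤ K) :
    (Fintype.card (Profile k) : ℝ) ≤ K ^ n := by
  simp only [Profile, Fintype.card_pi, Fintype.card_fin]
  calc ((∏ i, k i : ℕ) : ℝ) ≤ ((∏ _i : Fin n, K : ℕ) : ℝ) := by
        exact_mod_cast Finset.prod_le_prod' fun i _ => hK i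
    _ = K ^ n := by simp

theorem natCast_pow_eq_exp {n : ℕ} (hn : 0 < n) (m : ℕ) :
    (n : ℝ) ^ m = Real.exp (m * Real.log n) := by
  rw [Real.exp_nat_mul, Real.exp_log (by exact_mod_cast hn)]

/-- The union bound costs an exponent of order `n ^ 2`, against a failure probability of at most
`exp (-n ^ 3)`. -/
theorem union_bound_le {K : ℕ} (hKn : K ≤ n) (hn : 10 ≤ n) (hK : ∀ i, k i ≤ K) :
    2 * ((Fintype.card (Profile k) : ℝ) ^ 3 * 2 ^ n *
      (1 - Real.exp (-(K : ℝ) ^ 2)) ^ 2 ^ cubeDim n K) ≤ Real.exp (-n) := by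
  have hn' : (10 : ℝ) ≤ n := by exact_mod_cast hn
  have hA : (Fintype.card (Profile k) : ℝ) ≤ n ^ n :=
    (card_profile_le hK).trans (by gcongr)
  have h1 : (1 - Real.exp (-(K : ℝ) ^ 2)) ^ 2 ^ cubeDim n K ≤ Real.exp (-(n : ℝ) ^ 3) := by
    have h2 : 1 - Real.exp (-(K : ℝ) ^ 2) ≤ Real.exp (-Real.exp (-(K : ℝ) ^ 2)) :=
      Real.one_sub_le_exp_neg _
    have h0 : 0 ≤ 1 - Real.exp (-(K : ℝ) ^ 2) := by
      rw [sub_nonneg, Real.exp_le_one_iff, neg_nonpos]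
      positivity
    refine (pow_le_pow_left₀ h0 h2 _).trans ?_
    rw [← Real.exp_nat_mul, Real.exp_le_exp]
    push_cast
    linarith [exp_mul_two_pow_ge n K]
  have h2 : (Fintype.card (Profile k) : ℝ) ^ 3 ≤ Real.exp (3 * n * n) := by
    calc (Fintype.card (Profile k) : ℝ) ^ 3 ≤ ((n : ℝ) ^ n) ^ 3 := by gcongr
      _ = Real.exp (3 * (n * Real.log n)) := by
        rw [natCast_pow_eq_exp (by omega)]
        rw [← Real.exp_nat_mul]
        norm_num
      _ ≤ Real.exp (3 * n * n) := by
        rw [Real.exp_le_exp, mul_assoc]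
        gcongr
        exact Real.log_le_self (by linarith)
  have he2 : (2 : ℝ) ≤ Real.exp 1 := by linarith [Real.exp_one_gt_d9]
  have h3 : (2 : ℝ) ^ n ≤ Real.exp n := by
    rw [← Real.exp_one_pow]
    gcongr
  calc _ ≤ Real.exp 1 * (Real.exp (3 * n * n) * Real.exp n * Real.exp (-(n : ℝ) ^ 3)) := by
        have h0 : 0 ≤ 1 - Real.exp (-(K : ℝ) ^ 2) := by
          rw [sub_nonneg, Real.exp_le_one_iff, neg_nonpos]
          positivity
        gcongr
    _ = Real.exp (1 + (3 * n * n + n + -(n : ℝ) ^ 3)) := by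
        rw [Real.exp_add, Real.exp_add, Real.exp_add]
    _ ≤ Real.exp (-n) := by
        rw [Real.exp_le_exp]
        nlinarith [mul_nonneg (sub_nonneg.2 hn') (sq_nonneg (n : ℝ))]

variable [∀ i, NeZero (k i)]

theorem pr_hasTrap_le_exp {K : ℕ} (hk : ∀ i, 2 ≤ k i) (hK1 : 1 ≤ K) (hK : ∀ i, k i ≤ K)
    (hn : (100000000 : ℝ) ≤ n) (hd : 320 * (cubeDim n K : ℝ) ≤ n) {W : Finset (Fin n)}
    (hW : n ≤ 2 * W.card + 1) :
    pr (fun ω : Sample k => HasTrap ω W (cubeDim n K)) ≤ (n + 1) * Real.exp (-n) := by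
  have hW' : (n : ℝ) ≤ 2 * W.card + 1 := by exact_mod_cast hW
  have hK1' : (1 : ℝ) ≤ K := by exact_mod_cast hK1
  have hKd : (K : ℝ) ≤ cubeDim n K := by
    have : K ≤ cubeDim n K := by
      have := Nat.le_self_pow two_ne_zero K
      unfold cubeDim
      omega
    exact_mod_cast this
  have h20 : 20 * (cubeDim n K + 1) ≤ W.card := by
    have : (20 : ℝ) * (cubeDim n K + 1) ≤ W.card := by linarith
    exact_mod_cast this
  have hKn : K ≤ n := by
    have : (K : ℝ) ≤ n := by linarith
    exact_mod_cast this
  have hn10 : 10 ≤ n := by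
    have : (10 : ℝ) ≤ n := by linarith
    exact_mod_cast this
  refine (pr_hasTrap_le hk hK1 hK W h20).trans ?_
  rw [add_mul, one_mul]
  refine add_le_add ?_ (union_bound_le hKn hn10 hK)
  gcongr
  · have : (cubeDim n K : ℝ) ≤ n := by
      have h0 : (0 : ℝ) ≤ cubeDim n K := by positivity
      linarith
    exact_mod_cast this
  -- Here `W.card ≥ n / 3` and `K ≤ n / 320`, so `W.card ^ 2 / (10 * K)` exceeds `n`.
  · rw [le_div_iff₀ (by linarith)]
    have h3 : (n : ℝ) / 3 ≤ W.card := by linarith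
    have h4 : (n / 3 : ℝ) ^ 2 ≤ (W.card : ℝ) ^ 2 := by gcongr
    have h5 : (n : ℝ) * (10 * K) ≤ n * (n / 32) := by gcongr; linarith
    nlinarith

theorem pr_hasQuietPair_le_exp {K : ℕ} (hk : ∀ i, 2 ≤ k i) (hK : ∀ i, k i ≤ K)
    (hn : (100000000 : ℝ) ≤ n) (hd : 320 * (cubeDim n K : ℝ) ≤ n) (hKn : K ≤ n)
    (hlog : (8 * cubeDim n K + 6) * Real.log n ≤ (n : ℝ) / 4) :
    pr (fun ω : Sample k => HasQuietPair ω (2 * cubeDim n K)) ≤ Real.exp (-(2 / 5 * n)) := by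
  have hn0 : 0 < n := by
    have : (0 : ℝ) < n := by linarith
    exact_mod_cast this
  have hm : 2 * cubeDim n K + 1 ≤ n := by
    have : 2 * (cubeDim n K : ℝ) + 1 ≤ n := by linarith
    exact_mod_cast this
  refine (pr_hasQuietPair_le hK hm).trans ?_
  have h1 : ∏ i, (1 / (k i : ℝ)) ≤ Real.exp (-(n * Real.log 2)) := by
    calc ∏ i, (1 / (k i : ℝ)) ≤ ∏ _i : Fin n, (1 / 2 : ℝ) := by
          refine Finset.prod_le_prod (fun _ _ => by positivity) fun i _ => ?_
          have : (2 : ℝ) ≤ k i := by exact_mod_cast hk i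
          gcongr
      _ = Real.exp (-(n * Real.log 2)) := by
          rw [Finset.prod_const, card_univ, Fintype.card_fin, ← mul_neg, Real.exp_nat_mul,
            Real.exp_neg, Real.exp_log two_pos, one_div]
  have h2 : (n : ℝ) * K * (n ^ (2 * cubeDim n K + 1) * K ^ (2 * cubeDim n K + 1)) ^ 2 ≤
      Real.exp (n / 4) := by
    calc _ ≤ (n : ℝ) * n * (n ^ (2 * cubeDim n K + 1) * n ^ (2 * cubeDim n K + 1)) ^ 2 := by
          gcongr
      _ = (n : ℝ) ^ (8 * cubeDim n K + 6) := by ring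
      _ ≤ Real.exp (n / 4) := by
          rw [natCast_pow_eq_exp hn0, Real.exp_le_exp]
          push_cast
          exact hlog
  calc _ ≤ Real.exp (-(n * Real.log 2)) * Real.exp (n / 4) := by gcongr
    _ ≤ Real.exp (-(2 / 5 * n)) := by
        rw [← Real.exp_add, Real.exp_le_exp]
        nlinarith [Real.log_two_gt_d9]

theorem pr_isNash_and_not_reach_le {K : ℕ} (hn : 2 ≤ n) (hk : ∀ i, 2 ≤ k i)
    (hK : ∀ i, k i ≤ K) (hKn : (K : ℝ) ≤ 1 / 10 ^ 4 * Real.sqrt (n / Real.log n)) :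
    pr (fun ω : Sample k => (∃ e, IsNash ω e) ∧
      ¬ ∀ a, ∃ e, IsNash ω e ∧ Reach (br ω) a e) ≤ 1 / 2 * Real.exp (-(1 / 10 * n)) := by
  classical
  have hK2 : 2 ≤ K := (hk ⟨0, by omega⟩).trans (hK _)
  obtain ⟨hn8, hlog10, hlog⟩ := large_of_le hn hK2 hKn
  have hd : 320 * (cubeDim n K : ℝ) ≤ n := by
    have h0 : (0 : ℝ) ≤ cubeDim n K := by positivity
    nlinarith
  have hKd : (K : ℝ) ≤ cubeDim n K := by
    have : K ≤ cubeDim n K := by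
      have := Nat.le_self_pow two_ne_zero K
      unfold cubeDim
      omega
    exact_mod_cast this
  have hKn' : K ≤ n := by
    have : (K : ℝ) ≤ n := by
      have h0 : (0 : ℝ) ≤ cubeDim n K := by positivity
      linarith
    exact_mod_cast this
  obtain ⟨W, -, hW⟩ := Finset.exists_subset_card_eq
    (show n / 2 ≤ (univ : Finset (Fin n)).card by simp; omega)
  have hWc : Wᶜ.card = n - n / 2 := by rw [card_compl, Fintype.card_fin, hW]
  have h1 := pr_hasTrap_le_exp hk (by omega) hK hn8 hd (W := W) (by omega)
  have h2 := pr_hasTrap_le_exp hk (by omega) hK hn8 hd (W := Wᶜ) (by omega)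
  have h3 := pr_hasQuietPair_le_exp hk hK hn8 hd hKn' hlog
  refine (pr_mono fun ω h => ?_).trans ((pr_or_le _ _).trans
    (add_le_add h1 ((pr_or_le _ _).trans (add_le_add h2 h3)))) |>.trans ?_
  · by_contra! hcon
    exact h.2 (exists_reach_isNash hcon.1 hcon.2.1 hcon.2.2 h.1)
  · set x : ℝ := (n : ℝ)
    have h4 : x + 1 ≤ 2 * Real.exp (1 / 2 * x) := by
      have := Real.add_one_le_exp (1 / 2 * x)
      linarith
    have h5 : (x + 1) * Real.exp (-x) ≤ 2 * Real.exp (-(2 / 5 * x)) := by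
      calc (x + 1) * Real.exp (-x) ≤ 2 * Real.exp (1 / 2 * x) * Real.exp (-x) := by gcongr
        _ = 2 * Real.exp (1 / 2 * x + -x) := by rw [mul_assoc, Real.exp_add]
        _ ≤ 2 * Real.exp (-(2 / 5 * x)) := by gcongr; linarith
    have h6 : Real.exp (-(2 / 5 * x)) ≤ 1 / 10 * Real.exp (-(1 / 10 * x)) := by
      have h7 : Real.exp (-(2 / 5 * x)) = Real.exp (-(3 / 10 * x)) * Real.exp (-(1 / 10 * x)) := by
        rw [← Real.exp_add]; ring_nf
      have h8 : Real.exp (-(3 / 10 * x)) ≤ 1 / 10 := by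
        rw [Real.exp_neg, one_div]
        refine inv_anti₀ (by norm_num) ?_
        have := Real.add_one_le_exp (3 / 10 * x)
        linarith
      rw [h7]
      gcongr
    linarith

end Estimates

/-! ### Conclusion -/

section Main

variable {n : ℕ} {k : Fin n → ℕ}

theorem isSimple_bestResponseWithInertia (p : Fin n → Set.Ioo (0 : ℝ) 1) :
    (bestResponseWithInertia k p).IsSimple := fun _ => ⟨Prod.mk, fun _ _ _ => rfl⟩

/-- The factor 1/2 in the bound on bad games cancels against the lower bound 1/2 for the fraction of
games with an equilibrium. -/
theorem one_sub_exp_le_ratio (hn : 2 ≤ n) (hk : ∀ i, 2 ≤ k i)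
    (hK : ((Finset.univ.sup k : ℕ) : ℝ) ≤ 1 / 10 ^ 4 * Real.sqrt (n / Real.log n))
    (p : Fin n → Set.Ioo (0 : ℝ) 1) :
    1 - Real.exp (-(1 / 10) * n) ≤
      (Set.ncard {g : GenericGame k | (∃ a, g.1.IsPureNash a) ∧
          (bestResponseWithInertia k p).ConvergesToPureNash g} : ℝ) /
        (Set.ncard {g : GenericGame k | ∃ a, g.1.IsPureNash a} : ℝ) := by
  classical
  have : ∀ i, NeZero (k i) := fun i => ⟨by have := hk i; omega⟩
  have := Fintype.ofFinite (GenericGame k)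
  have hNash : ∀ g : GenericGame k, (∃ a, g.1.IsPureNash a) ↔ ∃ a, ∀ i, responses g.1 i a = a i :=
    fun g => exists_congr fun a => g.2.isPureNash_iff a
  have h1 : 1 / 2 ≤ pr (fun g : GenericGame k => ∃ a, g.1.IsPureNash a) := by
    rw [pr_congr hNash, pr_responses fun β => ∃ a, ∀ i, β i a = a i]
    exact half_le_pr_exists_isNash
  have h2 : pr (fun g : GenericGame k => (∃ a, g.1.IsPureNash a) ∧
      ¬ (bestResponseWithInertia k p).ConvergesToPureNash g) ≤
      1 / 2 * Real.exp (-(1 / 10 * n)) := by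
    refine le_trans (pr_mono (F := fun g : GenericGame k =>
      (fun β : (i : Fin n) → Profile k → Fin (k i) => (∃ e, ∀ i, β i e = e i) ∧
        ¬ ∀ a, ∃ e, (∀ i, β i e = e i) ∧ Reach β a e) (responses g.1)) fun g hg => ?_) ?_
    · refine ⟨(hNash g).1 hg.1, fun h => hg.2 (convergesToPureNash_of_reach p g fun a => ?_)⟩
      obtain ⟨e, he, hr⟩ := h a
      exact ⟨e, (g.2.isPureNash_iff e).2 he, hr⟩
    · rw [pr_responses fun β => (∃ e, ∀ i, β i e = e i) ∧
        ¬ ∀ a, ∃ e, (∀ i, β i e = e i) ∧ Reach β a e]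
      exact pr_isNash_and_not_reach_le hn hk (fun i => Finset.le_sup (mem_univ i)) hK
  have h3 : pr (fun g : GenericGame k => ∃ a, g.1.IsPureNash a) ≤
      pr (fun g : GenericGame k => (∃ a, g.1.IsPureNash a) ∧
        (bestResponseWithInertia k p).ConvergesToPureNash g) +
      pr (fun g : GenericGame k => (∃ a, g.1.IsPureNash a) ∧
        ¬ (bestResponseWithInertia k p).ConvergesToPureNash g) :=
    (pr_mono fun g hg => (em _).imp (And.intro hg) (And.intro hg)).trans (pr_or_le _ _)
  have hcard : (0 : ℝ) < Nat.card (GenericGame k) := by exact_mod_cast Nat.card_pos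
  rw [← div_div_div_cancel_right₀ hcard.ne' (Set.ncard _ : ℝ), ← pr_eq_ncard_div,
    ← pr_eq_ncard_div, le_div_iff₀ (by linarith)]
  have h4 : Real.exp (-(1 / 10) * n) = Real.exp (-(1 / 10 * n)) := by rw [neg_mul]
  rw [h4]
  have := Real.exp_pos (-(1 / 10 * n : ℝ))
  nlinarith

end Main

end GameDynamics

end

theorem theorem2 :
    ∃ c > (0 : ℝ), ∃ δ > (0 : ℝ), ∀ (n : ℕ) (k : Fin n → ℕ), 2 ≤ n → (∀ i, 2 ≤ k i) →
      ((Finset.univ.sup k : ℕ) : ℝ) ≤ δ * Real.sqrt ((n : ℝ) / Real.log n) →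
      ∀ p : Fin n → Set.Ioo (0 : ℝ) 1,
        (GameDynamics.bestResponseWithInertia k p).IsSimple ∧
        1 - Real.exp (-c * n) ≤
          (Set.ncard {g : GameDynamics.GenericGame k | (∃ a, g.1.IsPureNash a) ∧
              (GameDynamics.bestResponseWithInertia k p).ConvergesToPureNash g} : ℝ) /
            (Set.ncard {g : GameDynamics.GenericGame k | ∃ a, g.1.IsPureNash a} : ℝ) :=
  ⟨1 / 10, by norm_num, 1 / 10 ^ 4, by positivity, fun _ _ hn hk hK p =>
    ⟨GameDynamics.isSimple_bestResponseWithInertia p,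
      GameDynamics.one_sub_exp_le_ratio hn hk hK p⟩⟩
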